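/- Let $\{\pm1\}\subset\Gamma\subset\operatorname{SL}(2,\mathbb R)$ be a discrete subgroup such that $\Gamma\backslash\mathbb H$ is non-compact with finite hyperbolic area $\operatorname{vol}_{\mathbb H}(\mathcal F_\Gamma)$, where $\mathcal F_\Gamma\subset\mathbb H$ is a fundamental domain. Put $$n(s)=\begin{pmatrix}1&s\\0&1\end{pmatrix},\qquad a(t)=\begin{pmatrix}e^{t/2}&0\\0&e^{-t/2}\end{pmatrix},$$ and on $\mathcal X=\Gamma\backslash\operatorname{SL}(2,\mathbb R)$ let $\varphi_t(x)=x\,a(t)$, $h^-_s(x)=x\,n(s)$ and $h^+_s(x)=x\begin{pmatrix}1&0\\-s&1\end{pmatrix}$. Let $1,\dots,K$ ($K\ge1$) label a complete set of pairwise inequivalent cusps of $\Gamma$, and for each $\kappa$ let $g_\kappa\in\operatorname{SL}(2,\mathbb R)$ map the cusp $\kappa$ to a cusp at $\infty$ of width one; that is, the cusp is $g_\kappa^{-1}\infty$ and its stabiliser in $\Gamma$ is $\{\pm g_\kappa^{-1}n(m)g_\kappa:m\in\mathbb Z\}$. Put $x_\kappa=\Gamma g_\kappa^{-1}$, $\mathcal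 C_\kappa=\{h^-_s(x_\kappa):s\in\mathbb R\}$ and $\mathcal H_\kappa(R)=\{\varphi_t(x): x\in\mathcal C_\kappa,\ t\ge R\}$. For $\sigma=(\sigma_1,\dots,\sigma_K)\in\mathbb R^K$ let $\mathcal H(\sigma)=\bigcup_\kappa\mathcal H_\kappa(\sigma_\kappa)$ and $\Sigma^K(\sigma)=\{(s,t,\kappa): s\in[0,1),\ t\ge\sigma_\kappa,\ \kappa\in\{1,\dots,K\}\}$. For $(s,t,\kappa)\in\Sigma^K(\sigma)$ let $\eta_{1}(s,t,\kappa,\sigma)$ and $\eta_{-1}(s,t,\kappa,\sigma)\in(0,\infty]$ be the infimum of all $r>0$ such that $h^+_{r}(x)\in\mathcal H(\sigma)$, respectively $h^+_{-r}(x)\in\mathcal H(\sigma)$, where $x=\varphi_t(h^-_s(x_\kappa))$ (the first return time and the first backwards return time). Let $\overline\eta_1(\sigma)$ be the mean return time, i.e. the average of $\eta_1$ with respect to the normalised measure $e^{-t}\,dt\,ds$ on the section: $$\overline\eta_1(\sigma)=\frac{\sum_{\kappa=1}^K\int_0^1\int_{\sigma_\kappa}^\infty\eta_1(s,t,\kappa,\sigma)\,e^{-t}\,dt\,ds}{\sum_{\kappa=1}^K\int_0^1\int_{\sigma_\kappa}^\infty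 e^{-t}\,dt\,ds},$$ and for $r>0$ put $$\Psi_\sigma(r,s,t,\kappa)=\frac1{\overline\eta_1(\sigma)}\,\mathbf 1\big(r<\eta_{-1}(s,t,\kappa,\sigma)\big).$$ Let $\mathcal P^\ell_\Gamma=\{(0,1)g_\ell\gamma:\gamma\in\Gamma\}\subset\mathbb R^2$ (row vectors) and $\Delta_{-r}=\{u\in\mathbb R^2: -r u_2\le u_1<0,\ 0<u_2\le1\}$. Then for all $\sigma\in\mathbb R^K$, $r>0$ and $(s,t,\kappa)\in\Sigma^K(\sigma)$, $$\Psi_\sigma(r,s,t,\kappa)=\frac1{\overline\eta_1(\sigma)}\prod_{\ell=1}^K\mathbf 1\Big(e^{\sigma_\ell/2}\,\mathcal P^\ell_\Gamma\,g_\kappa^{-1}\,n(s)\,a(t)\cap\Delta_{-r}=\emptyset\Big),$$ and $$\overline\eta_1(\sigma)=\pi\operatorname{vol}_{\mathbb H}(\mathcal F_\Gamma)\Big(\sum_{\kappa=1}^Ke^{-\sigma_\kappa}\Big)^{-1};$$ in particular, $\overline\eta_1(\sigma)$ is finite. -/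

import Mathlib

open scoped MatrixGroups UpperHalfPlane ENNReal

noncomputable section

namespace CuspSection

/-- `n(s)`, the upper unipotent matrix with entry `s`. -/
def upperUni (s : ℝ) : SL(2, ℝ) := ⟨!![1, s; 0, 1], by simp [Matrix.det_fin_two]⟩

/-- `a(t) = diag(e^{t/2}, e^{-t/2})`. -/
def diagExp (t : ℝ) : SL(2, ℝ) :=
  ⟨!![Real.exp (t / 2), 0; 0, Real.exp (-t / 2)], by
    rw [Matrix.det_fin_two_of, mul_zero, sub_zero, ← Real.exp_add, neg_div, add_neg_cancel,
      Real.exp_zero]⟩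

/-- The lower unipotent matrix with entry `r`. -/
def lowerUni (r : ℝ) : SL(2, ℝ) := ⟨!![1, 0; r, 1], by simp [Matrix.det_fin_two]⟩

/-- The unit tangent bundle `Γ \ SL(2,ℝ)` of the surface `Γ \ ℍ`: the space of cosets `Γ g`. -/
abbrev TangentBundle (Γ : Subgroup SL(2, ℝ)) : Type := Quotient (QuotientGroup.rightRel Γ)

/-- The point `Γ g`. -/
def pt (Γ : Subgroup SL(2, ℝ)) (g : SL(2, ℝ)) : TangentBundle Γ :=
  Quotient.mk (QuotientGroup.rightRel Γ) g

/-- Right multiplication `Γ g ↦ Γ g h`. -/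
def rightMul (Γ : Subgroup SL(2, ℝ)) (h : SL(2, ℝ)) : TangentBundle Γ → TangentBundle Γ :=
  Quotient.map (fun g => g * h) fun a b hab => by
    have hab' : b * a⁻¹ ∈ Γ := QuotientGroup.rightRel_apply.1 hab
    refine QuotientGroup.rightRel_apply.2 ?_
    simpa [mul_assoc] using hab'

/-- The geodesic flow `φ_t`. -/
def geodesicFlow (Γ : Subgroup SL(2, ℝ)) (t : ℝ) : TangentBundle Γ → TangentBundle Γ :=
  rightMul Γ (diagExp t)

/-- The stable horocycle flow `h⁻_s`. -/
def stableFlow (Γ : Subgroup SL(2, ℝ)) (s : ℝ) : TangentBundle Γ → TangentBundle Γ :=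
  rightMul Γ (upperUni s)

/-- The unstable horocycle flow `h⁺_s`. -/
def unstableFlow (Γ : Subgroup SL(2, ℝ)) (s : ℝ) : TangentBundle Γ → TangentBundle Γ :=
  rightMul Γ (lowerUni (-s))

/-- The boundary point `g⁻¹ ∞`, which `g` maps to `∞`. -/
def boundaryPoint (g : SL(2, ℝ)) : OnePoint ℝ :=
  Matrix.SpecialLinearGroup.toGL g⁻¹ • OnePoint.infty

/-- The points `(g κ)⁻¹ ∞`, `κ = 1, …, K`, form a complete system of pairwise inequivalent cusps
of `Γ`, and each `g κ` maps its cusp to a cusp at `∞` of width one. (As `-1 ∈ Γ`, the stabiliser of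
the cusp is described up to sign.) -/
structure IsCuspSystem (Γ : Subgroup SL(2, ℝ)) {K : ℕ} (g : Fin K → SL(2, ℝ)) : Prop where
  width_one : ∀ (κ : Fin K) (γ : SL(2, ℝ)),
    (γ ∈ Γ ∧ Matrix.SpecialLinearGroup.toGL γ • boundaryPoint (g κ) = boundaryPoint (g κ)) ↔
      ∃ m : ℤ, γ = (g κ)⁻¹ * upperUni m * g κ ∨ γ = -((g κ)⁻¹ * upperUni m * g κ)
  complete : ∀ c : OnePoint ℝ, IsCusp c (Γ.map Matrix.SpecialLinearGroup.toGL) →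
    ∃! κ : Fin K, ∃ γ ∈ Γ, Matrix.SpecialLinearGroup.toGL γ • c = boundaryPoint (g κ)

/-- `F` is a (measurable) fundamental domain in `ℍ` for the group of Möbius transformations given
by `Γ`; `volume` on `ℍ` is the hyperbolic area `dx dy / y²`. -/
def IsFundDomain (Γ : Subgroup SL(2, ℝ)) (F : Set ℍ) : Prop :=
  MeasureTheory.IsFundamentalDomain (Γ.map (MulAction.toPermHom SL(2, ℝ) ℍ)) F
    MeasureTheory.volume

variable (Γ : Subgroup SL(2, ℝ)) {K : ℕ} (g : Fin K → SL(2, ℝ)) (σ : Fin K → ℝ)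

/-- The closed stable horocycle `C_κ` of length one, through the base point `x_κ = Γ (g κ)⁻¹`. -/
def closedHorocycle (κ : Fin K) : Set (TangentBundle Γ) :=
  Set.range fun s : ℝ => stableFlow Γ s (pt Γ (g κ)⁻¹)

/-- The section `H_κ(R) = {φ_t(C_κ) : t ≥ R}`. -/
def cuspSection (κ : Fin K) (R : ℝ) : Set (TangentBundle Γ) :=
  ⋃ t ∈ Set.Ici R, geodesicFlow Γ t '' closedHorocycle Γ g κ

/-- The section `H(σ, R) = ⋃_κ H_κ(σ_κ + R)`. -/
def totalSection (R : ℝ) : Set (TangentBundle Γ) :=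
  ⋃ κ : Fin K, cuspSection Γ g κ (σ κ + R)

/-- The parametrisation `ι(s, t, κ) = φ_t (h⁻_s (x_κ))`. -/
def embed (s t : ℝ) (κ : Fin K) : TangentBundle Γ :=
  geodesicFlow Γ t (stableFlow Γ s (pt Γ (g κ)⁻¹))

/-- The first return time `η₁(s, t, κ, σ)` of `ι(s, t, κ)` to `H(σ, 0)` under the unstable horocycle
flow (`∞` if there is no return). -/
def returnTime (s t : ℝ) (κ : Fin K) : ℝ≥0∞ :=
  ⨅ (r : ℝ) (_ : 0 < r) (_ : unstableFlow Γ r (embed Γ g s t κ) ∈ totalSection Γ g σ 0),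
    ENNReal.ofReal r

/-- The first backwards return time `η₋₁(s, t, κ, σ)`. -/
def backReturnTime (s t : ℝ) (κ : Fin K) : ℝ≥0∞ :=
  ⨅ (r : ℝ) (_ : 0 < r) (_ : unstableFlow Γ (-r) (embed Γ g s t κ) ∈ totalSection Γ g σ 0),
    ENNReal.ofReal r

/-- Integration over `Σ^K(σ) = {(s, t, κ) : s ∈ [0,1), t ≥ σ_κ}` against the measure
`e^{-t} dt ds` on each of the `K` components. -/
def sectionIntegral (f : ℝ → ℝ → Fin K → ℝ≥0∞) : ℝ≥0∞ :=
  ∑ κ : Fin K, ∫⁻ s in Set.Ico (0 : ℝ) 1, ∫⁻ t in Set.Ici (σ κ),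
    f s t κ * ENNReal.ofReal (Real.exp (-t))

/-- The mean return time `η̄₁(σ)`: the average of `η₁` over the section, i.e. its integral against
the measure above, normalised to a probability measure. -/
def meanReturnTime : ℝ≥0∞ :=
  sectionIntegral σ (returnTime Γ g σ) / sectionIntegral σ (fun _ _ _ => 1)

open Classical in
/-- The density `Ψ_σ(r, s, t, κ) = η̄₁(σ)⁻¹ 1(r < η₋₁(s, t, κ, σ))`. -/
def density (r s t : ℝ) (κ : Fin K) : ℝ :=
  1 / (meanReturnTime Γ g σ).toReal *
    if ENNReal.ofReal r < backReturnTime Γ g σ s t κ then 1 else 0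

/-- The point set `P^ℓ_Γ = (0,1) g_ℓ Γ` of row vectors. -/
def cuspOrbit (ℓ : Fin K) : Set (Fin 2 → ℝ) :=
  {p | ∃ γ ∈ Γ, p = Matrix.vecMul ![0, 1] (g ℓ * γ).1}

/-- The triangle `Δ_{-X} = {u : -X u₂ ≤ u₁ < 0, 0 < u₂ ≤ 1}`. -/
def negTriangle (X : ℝ) : Set (Fin 2 → ℝ) :=
  {u | -X * u 1 ≤ u 0 ∧ u 0 < 0 ∧ 0 < u 1 ∧ u 1 ≤ 1}

/-- The scaled and deformed point set `c P h`. -/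
def scaledSet (c : ℝ) (P : Set (Fin 2 → ℝ)) (h : SL(2, ℝ)) : Set (Fin 2 → ℝ) :=
  (fun p => c • Matrix.vecMul p h.1) '' P

open Classical in
/-- The indicator function `1(S = ∅)`. -/
def emptyIndicator (S : Set (Fin 2 → ℝ)) : ℝ := if S = ∅ then 1 else 0

end CuspSection

end

open scoped MatrixGroups UpperHalfPlane ENNReal

open MeasureTheory Set

noncomputable section

namespace CuspSection

/-! Everything is read off from the scaled row vectors `e^{σ_ℓ/2} (0,1) g_ℓ γ h` (`cuspVectors`).
The coset `Γ h` lies in the section exactly when one of them lies on the vertical segment `{0} ×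
(0,1]` (`pt_mem_totalSection`). The unstable flow shears row vectors, so a hit at time `r` is a
vector with `0 < u₂ ≤ 1` and slope `u₁/u₂ = r`. Discreteness of `Γ` makes these vectors locally
finite, so return times are attained, and `r < η₋₁` says that no vector lies in the triangle
`Δ_{-r}`. This is the density formula.

The mean return time comes from computing the Haar volume of `Γ \ SL(2,ℝ)` in two ways. Haar measure
is built as Lebesgue measure in the bottom row and a unipotent coordinate, which makes right
invariance evident. Polar coordinates for the bottom row turn it into `½ dθ` times hyperbolic area,
which gives left invariance and shows that its image on `ℍ` is `π` times the area. Since `-1 ∈ Γ`,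
half of the lift of `F` is a fundamental domain, of volume `π vol(F) / 2`.

In the coordinates `n(x) a(t) n⁻(-r)`, with `n⁻` lower unipotent, the same measure is `½ e^{-t} dx
dt dr`. A second fundamental domain is the union of the flow boxes: the orbit pieces from a section
point up to its first return (`isFundamentalDomain_flowBoxes`). Their total volume is half the
integral of `η₁`. Equating volumes gives `∫ η₁ = π vol(F)`, and division by the section mass `∑
e^{-σ_κ}` finishes. The covering property needs almost every orbit to meet the section in the past,
which follows from right invariance and finite volume (`ae_exists_cuspVector`). -/

@[simp] lemma upperUni_coe (s : ℝ) : (upperUni s : Matrix (Fin 2) (Fin 2) ℝ) = !![1, s; 0, 1] := rfl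

@[simp] lemma lowerUni_coe (s : ℝ) : (lowerUni s : Matrix (Fin 2) (Fin 2) ℝ) = !![1, 0; s, 1] := rfl

@[simp] lemma diagExp_coe (t : ℝ) : (diagExp t : Matrix (Fin 2) (Fin 2) ℝ) =
    !![Real.exp (t / 2), 0; 0, Real.exp (-t / 2)] := rfl

lemma mul_apply_two (A B : SL(2, ℝ)) (i j : Fin 2) :
    (A * B) i j = A i 0 * B 0 j + A i 1 * B 1 j := by
  rw [Matrix.SpecialLinearGroup.coe_mul, Matrix.mul_apply, Fin.sum_univ_two]

lemma det_eq_one_two (A : SL(2, ℝ)) : A 0 0 * A 1 1 - A 0 1 * A 1 0 = 1 := by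
  have := A.2
  rwa [Matrix.det_fin_two] at this

lemma ext_two {A B : SL(2, ℝ)} (h00 : A 0 0 = B 0 0) (h01 : A 0 1 = B 0 1)
    (h10 : A 1 0 = B 1 0) (h11 : A 1 1 = B 1 1) : A = B := by
  ext i j
  fin_cases i <;> fin_cases j <;> assumption

/-! ### Measurable structure on `SL(2, ℝ)` -/

instance instMeasurableSpaceSL : MeasurableSpace SL(2, ℝ) :=
  MeasurableSpace.comap (fun (g : SL(2, ℝ)) (i j : Fin 2) => g i j) inferInstance

lemma measurable_SL_iff {α : Type*} [MeasurableSpace α] {f : α → SL(2, ℝ)} :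
    Measurable f ↔ ∀ i j, Measurable fun x => f x i j := by
  rw [measurable_comap_iff, measurable_pi_iff]
  simp only [measurable_pi_iff]
  rfl

lemma measurable_entry (i j : Fin 2) : Measurable fun h : SL(2, ℝ) => h i j :=
  measurable_SL_iff.1 measurable_id i j

lemma measurable_SL_mul_left (g : SL(2, ℝ)) : Measurable fun h : SL(2, ℝ) => g * h := by
  refine measurable_SL_iff.2 fun i j => ?_
  simp only [mul_apply_two]
  exact ((measurable_entry _ _).const_mul _).add ((measurable_entry _ _).const_mul _)

lemma measurable_SL_mul_right (g : SL(2, ℝ)) : Measurable fun h : SL(2, ℝ) => h * g := by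
  refine measurable_SL_iff.2 fun i j => ?_
  simp only [mul_apply_two]
  exact ((measurable_entry _ _).mul_const _).add ((measurable_entry _ _).mul_const _)

/-! ### Haar measure via the bottom row and a unipotent coordinate -/

/-- The entries of `frame v s`. -/
def frameMatrix (v : ℝ × ℝ) (s : ℝ) : Matrix (Fin 2) (Fin 2) ℝ :=
  !![v.2 / (v.1 ^ 2 + v.2 ^ 2) + s * v.1, -v.1 / (v.1 ^ 2 + v.2 ^ 2) + s * v.2; v.1, v.2]

lemma normSq_ne_zero {v : ℝ × ℝ} (hv : v ≠ 0) : v.1 ^ 2 + v.2 ^ 2 ≠ 0 := by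
  intro h
  apply hv
  ext
  · simp; nlinarith [sq_nonneg v.1, sq_nonneg v.2]
  · simp; nlinarith [sq_nonneg v.1, sq_nonneg v.2]

open Classical in
/-- For `v ≠ 0`, the matrix with bottom row `v` for which `frame v s • I = s + I / |v|²`. -/
def frame (v : ℝ × ℝ) (s : ℝ) : SL(2, ℝ) :=
  if hv : v = 0 then 1 else ⟨frameMatrix v s, by
    have := normSq_ne_zero hv
    rw [frameMatrix, Matrix.det_fin_two_of]
    field_simp
    ring⟩

lemma frame_coe {v : ℝ × ℝ} (hv : v ≠ 0) (s : ℝ) :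
    (frame v s : Matrix (Fin 2) (Fin 2) ℝ) = frameMatrix v s := by
  simp [frame, hv]

lemma measurable_frame : Measurable fun p : (ℝ × ℝ) × ℝ => frame p.1 p.2 := by
  classical
  refine measurable_SL_iff.2 fun i j => ?_
  have : (fun p : (ℝ × ℝ) × ℝ => (frame p.1 p.2) i j) =
      fun p => if p.1 = 0 then (1 : SL(2, ℝ)) i j else frameMatrix p.1 p.2 i j := by
    funext p
    split_ifs with h
    · simp [frame, h]
    · rw [frame_coe h]
  rw [this]
  refine Measurable.ite (measurable_fst (measurableSet_singleton _)) measurable_const ?_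
  fin_cases i <;> fin_cases j <;> simp [frameMatrix] <;> fun_prop

/-- The bottom row of a matrix. -/
def bottomRow (h : SL(2, ℝ)) : ℝ × ℝ := (h 1 0, h 1 1)

lemma bottomRow_ne_zero (h : SL(2, ℝ)) : bottomRow h ≠ 0 := by
  intro h0
  have h1 : h 1 0 = 0 := congrArg Prod.fst h0
  have h2 : h 1 1 = 0 := congrArg Prod.snd h0
  have := det_eq_one_two h
  simp [h1, h2] at this

lemma measurable_bottomRow : Measurable bottomRow :=
  (measurable_entry _ _).prodMk (measurable_entry _ _)

/-- The unipotent coordinate of `h`. -/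
def shift (h : SL(2, ℝ)) : ℝ :=
  (h 0 0 * h 1 0 + h 0 1 * h 1 1) / (h 1 0 ^ 2 + h 1 1 ^ 2)

lemma measurable_shift : Measurable shift :=
  (((measurable_entry _ _).mul (measurable_entry _ _)).add
    ((measurable_entry _ _).mul (measurable_entry _ _))).div
      (((measurable_entry _ _).pow_const 2).add ((measurable_entry _ _).pow_const 2))

lemma frame_bottomRow_shift (h : SL(2, ℝ)) : frame (bottomRow h) (shift h) = h := by
  have hv := frame_coe (bottomRow_ne_zero h) (shift h)
  have h0 : h 1 0 ^ 2 + h 1 1 ^ 2 ≠ 0 := normSq_ne_zero (bottomRow_ne_zero h)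
  have hd := det_eq_one_two h
  apply ext_two <;> rw [hv] <;> simp [frameMatrix, bottomRow, shift] <;> field_simp
  · linear_combination -(h 1 1) * hd
  · linear_combination h 1 0 * hd

lemma upperUni_mul_frame {v : ℝ × ℝ} (hv : v ≠ 0) (s s' : ℝ) :
    upperUni s' * frame v s = frame v (s + s') := by
  apply ext_two <;> simp only [mul_apply_two, frame_coe hv] <;> simp [frameMatrix] <;> ring

lemma bottomRow_frame {v : ℝ × ℝ} (hv : v ≠ 0) (s : ℝ) : bottomRow (frame v s) = v := by
  ext <;> simp [bottomRow, frame_coe hv, frameMatrix]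

/-- The Haar measure on `SL(2, ℝ)`, as Lebesgue measure in the coordinates `frame`. -/
def haarSL : Measure SL(2, ℝ) :=
  Measure.map (fun p : (ℝ × ℝ) × ℝ => frame p.1 p.2) volume

lemma lintegral_haarSL {f : SL(2, ℝ) → ℝ≥0∞} (hf : Measurable f) :
    ∫⁻ h, f h ∂haarSL = ∫⁻ v : ℝ × ℝ, ∫⁻ s : ℝ, f (frame v s) := by
  rw [haarSL, lintegral_map hf measurable_frame, Measure.volume_eq_prod]
  exact lintegral_prod _ (hf.comp measurable_frame).aemeasurable

/-- The action of `h` on row vectors. -/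
def rowMul (h : SL(2, ℝ)) (v : ℝ × ℝ) : ℝ × ℝ :=
  (v.1 * h 0 0 + v.2 * h 1 0, v.1 * h 0 1 + v.2 * h 1 1)

lemma bottomRow_mul (a h : SL(2, ℝ)) : bottomRow (a * h) = rowMul h (bottomRow a) := by
  simp [bottomRow, rowMul, mul_apply_two]

/-- A linear map of determinant one preserves Lebesgue measure; the matrix of the map is the
transpose of `h`, because vectors are rows. -/
lemma measurePreserving_rowMul (h : SL(2, ℝ)) :
    MeasurePreserving (rowMul h) (volume : Measure (ℝ × ℝ)) volume := by
  let A : (ℝ × ℝ) →ₗ[ℝ] ℝ × ℝ :=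
    Matrix.toLin (Module.Basis.finTwoProd ℝ) (Module.Basis.finTwoProd ℝ) !![h 0 0, h 1 0; h 0 1, h 1 1]
  have hA : (A : ℝ × ℝ → ℝ × ℝ) = rowMul h := by
    funext v
    simp only [A, Matrix.toLin_finTwoProd_apply, rowMul]
    ext <;> ring
  have hdet : LinearMap.det A = 1 := by
    simp only [A, LinearMap.det_toLin, Matrix.det_fin_two_of]
    linear_combination det_eq_one_two h
  refine ⟨hA ▸ A.continuous_of_finiteDimensional.measurable, ?_⟩
  rw [← hA, Measure.map_linearMap_addHaar_eq_smul_addHaar _ (by rw [hdet]; exact one_ne_zero), hdet]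
  simp

/-- In frame coordinates right multiplication is a skew product: `v` moves by the area-preserving
map `rowMul h`, and `s` is translated by an amount depending only on `v`, since left multiplication
by `n(s)` commutes with it. -/
lemma measurePreserving_mul_right (h : SL(2, ℝ)) :
    MeasurePreserving (fun a => a * h) haarSL haarSL := by
  refine ⟨measurable_SL_mul_right h, ?_⟩
  let c : ℝ × ℝ → ℝ := fun v => shift (frame v 0 * h)
  have hc : Measurable c := measurable_shift.comp ((measurable_SL_mul_right h).comp
    (measurable_frame.comp (measurable_id.prodMk measurable_const)))
  have hT : MeasurePreserving (fun p : (ℝ × ℝ) × ℝ => (rowMul h p.1, p.2 + c p.1))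
      ((volume : Measure (ℝ × ℝ)).prod volume) (volume.prod volume) :=
    (measurePreserving_rowMul h).skew_product (g := fun v s => s + c v)
      (measurable_snd.add (hc.comp measurable_fst))
      (Filter.Eventually.of_forall fun v => (measurePreserving_add_right volume (c v)).map_eq)
  rw [haarSL, Measure.map_map (measurable_SL_mul_right h) measurable_frame]
  nth_rewrite 2 [Measure.volume_eq_prod]
  rw [← hT.map_eq, Measure.map_map measurable_frame hT.measurable, ← Measure.volume_eq_prod]
  refine Measure.map_congr ?_
  have hne : ∀ᵐ p : (ℝ × ℝ) × ℝ, p.1 ≠ 0 := by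
    rw [Measure.volume_eq_prod]
    exact Measure.quasiMeasurePreserving_fst.ae (Measure.ae_ne volume 0)
  filter_upwards [hne] with p hp
  have h1 : frame p.1 p.2 = upperUni p.2 * frame p.1 0 := by
    rw [upperUni_mul_frame hp, zero_add]
  have h2 : bottomRow (frame p.1 0 * h) = rowMul h p.1 := by
    rw [bottomRow_mul, bottomRow_frame hp]
  have h3 : rowMul h p.1 ≠ 0 := h2 ▸ bottomRow_ne_zero _
  have h4 := frame_bottomRow_shift (frame p.1 0 * h)
  rw [h2] at h4
  simp only [Function.comp_apply]
  rw [h1, mul_assoc, ← h4, upperUni_mul_frame h3, add_comm]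

/-! ### Polar coordinates -/

open Classical in
/-- The point `x + i y` for `y > 0`. -/
def upPt (x y : ℝ) : ℍ := if hy : 0 < y then ⟨⟨x, y⟩, hy⟩ else UpperHalfPlane.I

lemma upPt_coe {y : ℝ} (hy : 0 < y) (x : ℝ) : (upPt x y : ℂ) = ⟨x, y⟩ := by
  simp [upPt, hy]

lemma measurable_upPt : Measurable fun p : ℝ × ℝ => upPt p.1 p.2 := by
  classical
  rw [measurable_comap_iff]
  have : (UpperHalfPlane.coe ∘ fun p : ℝ × ℝ => upPt p.1 p.2) =
      fun p => if 0 < p.2 then Complex.measurableEquivRealProd.symm p else Complex.I := by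
    funext p
    by_cases hp : 0 < p.2
    · simp [hp, upPt_coe hp]
    · simp [upPt, hp]
  rw [this]
  exact Measurable.ite (measurableSet_lt measurable_const measurable_snd)
    Complex.measurableEquivRealProd.symm.measurable measurable_const

lemma lintegral_upperHalfPlane {f : ℍ → ℝ≥0∞} (hf : Measurable f) :
    ∫⁻ z, f z = ∫⁻ x : ℝ, ∫⁻ y in Ioi (0 : ℝ), ENNReal.ofReal (1 / y ^ 2) * f (upPt x y) := by
  have hd : Measurable fun z : ℍ => (((1 / NNReal.mk z.im z.im_pos.le : NNReal) ^ 2 : NNReal) : ℝ≥0∞) := by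
    have h1 : Measurable fun z : ℍ => NNReal.mk z.im z.im_pos.le :=
      (UpperHalfPlane.continuous_im.measurable).subtype_mk
    exact ((measurable_const.div h1).pow_const 2).coe_nnreal_ennreal
  have hmp : MeasurePreserving UpperHalfPlane.coe (volume.comap UpperHalfPlane.coe)
      (volume.restrict (range UpperHalfPlane.coe)) :=
    ⟨UpperHalfPlane.measurable_coe, by rw [UpperHalfPlane.measurableEmbedding_coe.map_comap]⟩
  have hg : Measurable fun p : ℝ × ℝ => ENNReal.ofReal (1 / p.2 ^ 2) * f (upPt p.1 p.2) :=
    Measurable.mul (by fun_prop) (hf.comp measurable_upPt)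
  rw [UpperHalfPlane.volume_def, lintegral_withDensity_eq_lintegral_mul _ hd hf]
  have h2 : ∀ z : ℍ, ((fun z : ℍ => (((1 / NNReal.mk z.im z.im_pos.le : NNReal) ^ 2 : NNReal) : ℝ≥0∞)) * f) z
      = (fun w : ℂ => ENNReal.ofReal (1 / w.im ^ 2) * f (upPt w.re w.im)) z := by
    intro z
    have : upPt z.re z.im = z := by
      apply UpperHalfPlane.ext
      rw [upPt_coe z.im_pos]
      rfl
    simp only [Pi.mul_apply, UpperHalfPlane.coe_im, UpperHalfPlane.coe_re, this]
    congr 1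
    rw [← ENNReal.ofReal_coe_nnreal]
    congr 1
    push_cast
    simp
  simp_rw [h2]
  rw [hmp.lintegral_comp_emb UpperHalfPlane.measurableEmbedding_coe
    (fun w : ℂ => ENNReal.ofReal (1 / w.im ^ 2) * f (upPt w.re w.im))]
  have hr : range UpperHalfPlane.coe = Complex.measurableEquivRealProd ⁻¹' (univ ×ˢ Ioi (0 : ℝ)) := by
    rw [UpperHalfPlane.range_coe]
    ext w
    simp [Complex.measurableEquivRealProd]
  rw [hr]
  refine (Complex.volume_preserving_equiv_real_prod.setLIntegral_comp_preimage
    (MeasurableSet.univ.prod measurableSet_Ioi) hg).trans ?_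
  rw [Measure.volume_eq_prod, setLIntegral_prod _ hg.aemeasurable, Measure.restrict_univ]

/-- The rotation with bottom row `(cos θ, sin θ)`. -/
def rot (θ : ℝ) : SL(2, ℝ) :=
  ⟨!![Real.sin θ, -Real.cos θ; Real.cos θ, Real.sin θ], by
    rw [Matrix.det_fin_two_of]
    linear_combination Real.sin_sq_add_cos_sq θ⟩

@[simp] lemma rot_coe (θ : ℝ) : (rot θ : Matrix (Fin 2) (Fin 2) ℝ) =
    !![Real.sin θ, -Real.cos θ; Real.cos θ, Real.sin θ] := rfl

lemma measurable_toSL2R : Measurable UpperHalfPlane.toSL2R := by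
  have him : Measurable UpperHalfPlane.im := UpperHalfPlane.continuous_im.measurable
  have hre : Measurable UpperHalfPlane.re := UpperHalfPlane.continuous_re.measurable
  refine measurable_SL_iff.2 fun i j => ?_
  fin_cases i <;> fin_cases j <;> simp <;> fun_prop

lemma measurable_toSL2R_mul_rot :
    Measurable fun p : ℍ × ℝ => p.1.toSL2R * rot p.2 := by
  have h1 : ∀ i j, Measurable fun p : ℍ × ℝ => p.1.toSL2R i j := fun i j =>
    (measurable_SL_iff.1 measurable_toSL2R i j).comp measurable_fst
  have h2 : ∀ i j, Measurable fun p : ℍ × ℝ => rot p.2 i j := by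
    intro i j
    fin_cases i <;> fin_cases j <;> simp <;> fun_prop
  refine measurable_SL_iff.2 fun i j => ?_
  simp only [mul_apply_two]
  exact ((h1 _ _).mul (h2 _ _)).add ((h1 _ _).mul (h2 _ _))

/-- Iwasawa decomposition: the length of the bottom row fixes the height `y = ρ⁻²`, and its
direction fixes the rotation. -/
lemma frame_polar {ρ : ℝ} (hρ : 0 < ρ) (θ s : ℝ) :
    frame (ρ * Real.cos θ, ρ * Real.sin θ) s = (upPt s (1 / ρ ^ 2)).toSL2R * rot θ := by
  have hN : (ρ * Real.cos θ) ^ 2 + (ρ * Real.sin θ) ^ 2 = ρ ^ 2 := by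
    linear_combination ρ ^ 2 * Real.sin_sq_add_cos_sq θ
  have hne : ((ρ * Real.cos θ, ρ * Real.sin θ) : ℝ × ℝ) ≠ 0 := by
    intro h
    have h1 : ρ * Real.cos θ = 0 := congrArg Prod.fst h
    have h2 : ρ * Real.sin θ = 0 := congrArg Prod.snd h
    rw [h1, h2] at hN
    have := pow_pos hρ 2
    linarith
  have hy : 0 < 1 / ρ ^ 2 := by positivity
  have hc := upPt_coe hy s
  have him : (upPt s (1 / ρ ^ 2)).im = 1 / ρ ^ 2 := congrArg Complex.im hc
  have hre : (upPt s (1 / ρ ^ 2)).re = s := congrArg Complex.re hc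
  have hsq : √(1 / ρ ^ 2) = 1 / ρ := by
    rw [Real.sqrt_div zero_le_one, Real.sqrt_one, Real.sqrt_sq hρ.le]
  apply ext_two <;> rw [frame_coe hne, mul_apply_two] <;>
    simp only [UpperHalfPlane.coe_toSL2R, rot_coe, him, hre, hsq, frameMatrix, hN] <;> simp <;> field_simp

/-- Change of variables `y = ρ⁻²`. -/
lemma lintegral_Ioi_inv_sq (f : ℝ → ℝ≥0∞) :
    ∫⁻ y in Ioi (0 : ℝ), ENNReal.ofReal (1 / y ^ 2) * f y =
      ∫⁻ ρ in Ioi (0 : ℝ), 2 * (ENNReal.ofReal ρ * f (1 / ρ ^ 2)) := by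
  have himg : (fun ρ : ℝ => 1 / ρ ^ 2) '' Ioi 0 = Ioi 0 := by
    ext y
    constructor
    · rintro ⟨ρ, hρ, rfl⟩
      have : (0 : ℝ) < ρ := hρ
      exact mem_Ioi.2 (by positivity)
    · intro hy
      have : (0 : ℝ) < y := hy
      refine ⟨1 / √y, mem_Ioi.2 (by positivity), ?_⟩
      simp [Real.sq_sqrt this.le]
  have hinj : InjOn (fun ρ : ℝ => 1 / ρ ^ 2) (Ioi 0) := by
    intro a ha b hb hab
    have ha : (0 : ℝ) < a := ha
    have hb : (0 : ℝ) < b := hb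
    simp only [one_div, inv_inj] at hab
    exact (pow_left_inj₀ ha.le hb.le two_ne_zero).1 hab
  have hderiv : ∀ ρ ∈ Ioi (0 : ℝ),
      HasDerivWithinAt (fun ρ : ℝ => 1 / ρ ^ 2) (-2 / ρ ^ 3) (Ioi 0) ρ := by
    intro ρ hρ
    have : (0 : ℝ) < ρ := hρ
    have h := ((hasDerivAt_pow 2 ρ).inv (by positivity)).hasDerivWithinAt (s := Ioi 0)
    simp only [one_div]
    convert! h using 1
    field_simp
    ring
  rw [← himg, lintegral_image_eq_lintegral_abs_deriv_mul measurableSet_Ioi hderiv hinj, himg]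
  refine setLIntegral_congr_fun measurableSet_Ioi fun ρ hρ => ?_
  have hρ : (0 : ℝ) < ρ := hρ
  rw [← mul_assoc, ← mul_assoc, ← ENNReal.ofReal_mul (abs_nonneg _),
    show (2 : ℝ≥0∞) = ENNReal.ofReal 2 by simp, ← ENNReal.ofReal_mul zero_le_two]
  congr 2
  rw [abs_div, abs_of_pos (pow_pos hρ 3)]
  simp
  field_simp

/-- With `y = ρ⁻²` one has `dy/y² = 2ρ dρ` up to orientation, so `ρ dρ dθ ds` becomes half of
hyperbolic area times `dθ`. -/
lemma lintegral_haarSL_polar {f : SL(2, ℝ) → ℝ≥0∞} (hf : Measurable f) :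
    ∫⁻ h, f h ∂haarSL = ∫⁻ z : ℍ, 2⁻¹ * ∫⁻ θ in Ioo (-Real.pi) Real.pi, f (z.toSL2R * rot θ) := by
  have hfm := hf.comp measurable_frame
  have hJ : Measurable fun z : ℍ => ∫⁻ θ in Ioo (-Real.pi) Real.pi, f (z.toSL2R * rot θ) :=
    (hf.comp measurable_toSL2R_mul_rot).lintegral_prod_right'
  have hframe : Measurable fun v : ℝ × ℝ => ∫⁻ s : ℝ, f (frame v s) := hfm.lintegral_prod_right'
  rw [lintegral_haarSL hf, ← lintegral_comp_polarCoord_symm,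
    lintegral_upperHalfPlane (hJ.const_mul _)]
  simp_rw [lintegral_Ioi_inv_sq]
  have hpolar : Measurable fun p : ℝ × ℝ => ((p.1 * Real.cos p.2, p.1 * Real.sin p.2) : ℝ × ℝ) := by
    fun_prop
  have hG : Measurable fun p : ℝ × ℝ =>
      ENNReal.ofReal p.1 • ∫⁻ s : ℝ, f (frame (polarCoord.symm p) s) :=
    (ENNReal.measurable_ofReal.comp measurable_fst).smul (hframe.comp hpolar)
  have htarget : polarCoord.target = Ioi (0 : ℝ) ×ˢ Ioo (-Real.pi) Real.pi := rfl
  rw [htarget, Measure.volume_eq_prod, setLIntegral_prod _ hG.aemeasurable]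
  have hswap : Measurable fun p : ℝ × ℝ => ENNReal.ofReal p.2 *
      ∫⁻ θ in Ioo (-Real.pi) Real.pi, f ((upPt p.1 (1 / p.2 ^ 2)).toSL2R * rot θ) := by
    have hinv : Measurable fun p : ℝ × ℝ => ((p.1, 1 / p.2 ^ 2) : ℝ × ℝ) := by fun_prop
    exact (ENNReal.measurable_ofReal.comp measurable_snd).mul (hJ.comp (measurable_upPt.comp hinv))
  have hright : ∀ s : ℝ, ∫⁻ ρ in Ioi (0 : ℝ), 2 * (ENNReal.ofReal ρ * (2⁻¹ *
      ∫⁻ θ in Ioo (-Real.pi) Real.pi, f ((upPt s (1 / ρ ^ 2)).toSL2R * rot θ))) =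
      ∫⁻ ρ in Ioi (0 : ℝ), ENNReal.ofReal ρ *
        ∫⁻ θ in Ioo (-Real.pi) Real.pi, f ((upPt s (1 / ρ ^ 2)).toSL2R * rot θ) := by
    intro s
    refine lintegral_congr fun ρ => ?_
    rw [mul_left_comm 2, ← mul_assoc 2, ENNReal.mul_inv_cancel two_ne_zero ENNReal.ofNat_ne_top,
      one_mul]
  simp_rw [hright]
  refine Eq.trans ?_ (lintegral_lintegral_swap hswap.aemeasurable).symm
  refine setLIntegral_congr_fun measurableSet_Ioi fun ρ hρ => ?_
  have hρ : (0 : ℝ) < ρ := hρ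
  have hm : Measurable fun p : ℝ × ℝ => f (frame (ρ * Real.cos p.1, ρ * Real.sin p.1) p.2) :=
    hf.comp (measurable_frame.comp ((by fun_prop : Measurable fun p : ℝ × ℝ =>
      ((ρ * Real.cos p.1, ρ * Real.sin p.1) : ℝ × ℝ)).prodMk measurable_snd))
  have hm' : Measurable fun s : ℝ =>
      ∫⁻ θ in Ioo (-Real.pi) Real.pi, f ((upPt s (1 / ρ ^ 2)).toSL2R * rot θ) :=
    hJ.comp (measurable_upPt.comp (measurable_id.prodMk measurable_const))
  simp only [polarCoord_symm_apply, smul_eq_mul]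
  rw [lintegral_const_mul' _ _ ENNReal.ofReal_ne_top, lintegral_const_mul _ hm',
    lintegral_lintegral_swap hm.aemeasurable]
  simp_rw [frame_polar hρ]

/-! ### Left invariance and the projection to the upper half-plane -/

/-- The rotation by `-α`. -/
def rotLeft (α : ℝ) : SL(2, ℝ) :=
  ⟨!![Real.cos α, Real.sin α; -Real.sin α, Real.cos α], by
    rw [Matrix.det_fin_two_of]
    linear_combination Real.sin_sq_add_cos_sq α⟩

@[simp] lemma rotLeft_coe (α : ℝ) : (rotLeft α : Matrix (Fin 2) (Fin 2) ℝ) =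
    !![Real.cos α, Real.sin α; -Real.sin α, Real.cos α] := rfl

lemma rotLeft_mul_rot (α θ : ℝ) : rotLeft α * rot θ = rot (θ + α) := by
  apply ext_two <;> rw [mul_apply_two] <;> simp [Real.sin_add, Real.cos_add] <;> ring

lemma smul_I_eq_I_iff (h : SL(2, ℝ)) :
    h • UpperHalfPlane.I = UpperHalfPlane.I ↔ h 0 0 = h 1 1 ∧ h 0 1 = -h 1 0 := by
  rw [UpperHalfPlane.ext_iff, UpperHalfPlane.coe_specialLinearGroup_apply, div_eq_iff, Complex.ext_iff]
  · simp
    constructor <;> rintro ⟨h1, h2⟩ <;> constructor <;> linarith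
  · exact UpperHalfPlane.denom_ne_zero (h : GL (Fin 2) ℝ) UpperHalfPlane.I

lemma exists_rotLeft_of_smul_I {h : SL(2, ℝ)} (hh : h • UpperHalfPlane.I = UpperHalfPlane.I) :
    ∃ α, h = rotLeft α := by
  obtain ⟨h1, h2⟩ := (smul_I_eq_I_iff h).1 hh
  have hd := det_eq_one_two h
  rw [h1, h2] at hd
  have hc : (⟨h 1 1, -h 1 0⟩ : ℂ) = ‖(⟨h 1 1, -h 1 0⟩ : ℂ)‖ *
      Complex.exp (Complex.arg ⟨h 1 1, -h 1 0⟩ * Complex.I) :=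
    (Complex.norm_mul_exp_arg_mul_I _).symm
  have hn : ‖(⟨h 1 1, -h 1 0⟩ : ℂ)‖ = 1 := by
    rw [Complex.norm_def, Complex.normSq_mk, Real.sqrt_eq_one]
    linarith
  rw [hn, Complex.ofReal_one, one_mul, Complex.exp_mul_I] at hc
  have hre := congrArg Complex.re hc
  have him := congrArg Complex.im hc
  simp [← Complex.ofReal_cos, ← Complex.ofReal_sin] at hre him
  refine ⟨Complex.arg ⟨h 1 1, -h 1 0⟩, ?_⟩
  apply ext_two <;> simp <;> linarith

/-- Both `g * z.toSL2R` and `(g • z).toSL2R` send `I` to `g • z`, so they differ by an element of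
the stabiliser of `I`. -/
lemma exists_toSL2R_smul (g : SL(2, ℝ)) (z : ℍ) :
    ∃ α, g * z.toSL2R = (g • z).toSL2R * rotLeft α := by
  obtain ⟨α, hα⟩ := exists_rotLeft_of_smul_I (h := ((g • z).toSL2R)⁻¹ * (g * z.toSL2R)) (by
    rw [mul_smul, mul_smul, UpperHalfPlane.toSL2R_smul_I, inv_smul_eq_iff,
      UpperHalfPlane.toSL2R_smul_I])
  exact ⟨α, by rw [← hα, mul_inv_cancel_left]⟩

lemma lintegral_Ioo_add_of_periodic {f : ℝ → ℝ≥0∞} (hf : Function.Periodic f (2 * Real.pi)) (α : ℝ) :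
    ∫⁻ θ in Ioo (-Real.pi) Real.pi, f (θ + α) = ∫⁻ θ in Ioo (-Real.pi) Real.pi, f θ := by
  have h1 : ∀ (t : ℝ) (k : AddSubgroup.zmultiples (2 * Real.pi)), f (k +ᵥ t) = f t := by
    rintro t ⟨_, n, rfl⟩
    rw [AddSubgroup.vadd_def, vadd_eq_add, add_comm]
    exact hf.zsmul n t
  have h2 := (isAddFundamentalDomain_Ioc Real.two_pi_pos (-Real.pi + α)).setLIntegral_eq
    (isAddFundamentalDomain_Ioc Real.two_pi_pos (-Real.pi)) f (fun k t => h1 t k)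
  have h3 := (measurePreserving_add_right (volume : Measure ℝ) α).setLIntegral_comp_preimage_emb
    (measurableEmbedding_addRight α) f (Ioc (-Real.pi + α) (-Real.pi + α + 2 * Real.pi))
  rw [setLIntegral_congr Ioo_ae_eq_Ioc, setLIntegral_congr Ioo_ae_eq_Ioc]
  simp only [preimage_add_const_Ioc] at h3
  ring_nf at h2 h3 ⊢
  rw [h3, h2]

lemma measurePreserving_SL_smul (g : SL(2, ℝ)) :
    MeasurePreserving (fun z : ℍ => g • z) volume volume :=
  measurePreserving_smul (Matrix.SpecialLinearGroup.mapGL ℝ g) volume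

lemma measurable_SL_smul_I : Measurable fun h : SL(2, ℝ) => h • UpperHalfPlane.I := by
  rw [measurable_comap_iff]
  have : (UpperHalfPlane.coe ∘ fun h : SL(2, ℝ) => h • UpperHalfPlane.I) =
      fun h => ((h 0 0 : ℂ) * Complex.I + h 0 1) / ((h 1 0 : ℂ) * Complex.I + h 1 1) := by
    funext h
    simp [UpperHalfPlane.coe_specialLinearGroup_apply]
  rw [this]
  have := fun i j => Complex.measurable_ofReal.comp (measurable_entry i j)
  exact (((this 0 0).mul_const _).add (this 0 1)).div (((this 1 0).mul_const _).add (this 1 1))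

/-- In polar coordinates `g` acts on `ℍ` by an area-preserving map and shifts the angle by an amount
depending on `z`; the shift disappears by periodicity in `θ`. -/
lemma measurePreserving_mul_left (g : SL(2, ℝ)) :
    MeasurePreserving (fun a => g * a) haarSL haarSL := by
  have hg := measurable_SL_mul_left g
  refine ⟨hg, Measure.ext_of_lintegral _ fun f hf => ?_⟩
  have hJ : Measurable fun z : ℍ => ∫⁻ θ in Ioo (-Real.pi) Real.pi, f (z.toSL2R * rot θ) :=
    (hf.comp measurable_toSL2R_mul_rot).lintegral_prod_right'
  rw [lintegral_map hf hg, lintegral_haarSL_polar (f := fun a => f (g * a)) (hf.comp hg), lintegral_haarSL_polar hf,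
    ← (measurePreserving_SL_smul g).lintegral_comp (hJ.const_mul _)]
  refine lintegral_congr fun z => ?_
  congr 1
  obtain ⟨α, hα⟩ := exists_toSL2R_smul g z
  have hper : Function.Periodic (fun θ => f ((g • z).toSL2R * rot θ)) (2 * Real.pi) := by
    intro θ
    have : rot (θ + 2 * Real.pi) = rot θ := by
      apply ext_two <;> simp
    simp only [this]
  rw [← lintegral_Ioo_add_of_periodic hper α]
  refine lintegral_congr fun θ => ?_
  rw [← mul_assoc, hα, mul_assoc, rotLeft_mul_rot]

lemma rot_smul_I (θ : ℝ) : rot θ • UpperHalfPlane.I = UpperHalfPlane.I :=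
  (smul_I_eq_I_iff _).2 ⟨by simp, by simp⟩

/-- The fibre over each point is a full circle of angles, of mass `½ · 2π = π`. -/
lemma map_smul_I_haarSL :
    haarSL.map (fun h : SL(2, ℝ) => h • UpperHalfPlane.I) = ENNReal.ofReal Real.pi • volume := by
  refine Measure.ext_of_lintegral _ fun f hf => ?_
  rw [lintegral_map hf measurable_SL_smul_I, 
    lintegral_haarSL_polar (f := fun a => f (a • UpperHalfPlane.I)) (hf.comp measurable_SL_smul_I),
    lintegral_smul_measure, smul_eq_mul, ← lintegral_const_mul _ hf]
  refine lintegral_congr fun z => ?_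
  simp only [mul_smul, rot_smul_I, UpperHalfPlane.toSL2R_smul_I, lintegral_const,
    Measure.restrict_apply_univ, Real.volume_Ioo]
  rw [mul_comm (f z), ← mul_assoc]
  congr 1
  rw [show Real.pi - -Real.pi = 2 * Real.pi by ring, ENNReal.ofReal_mul zero_le_two, ← mul_assoc,
    ENNReal.ofReal_ofNat, ENNReal.inv_mul_cancel two_ne_zero ENNReal.ofNat_ne_top, one_mul]

/-! ### Cusp vectors and their equivariance -/

lemma bottomRow_one_zero (h : SL(2, ℝ)) : (bottomRow h).1 = h 1 0 := rfl

lemma bottomRow_one_one (h : SL(2, ℝ)) : (bottomRow h).2 = h 1 1 := rfl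

/-- The scaled vectors `e^{σ_ℓ/2} (0, 1) g_ℓ γ h`, for all `ℓ` and all `γ ∈ Γ`. -/
def cuspVectors (Γ : Subgroup SL(2, ℝ)) {K : ℕ} (g : Fin K → SL(2, ℝ)) (σ : Fin K → ℝ)
    (h : SL(2, ℝ)) : Set (ℝ × ℝ) :=
  {u | ∃ ℓ, ∃ γ ∈ Γ, u = Real.exp (σ ℓ / 2) • bottomRow (g ℓ * γ * h)}

variable {Γ : Subgroup SL(2, ℝ)} {K : ℕ} {g : Fin K → SL(2, ℝ)} {σ : Fin K → ℝ}

lemma cuspVectors_mul_left {γ : SL(2, ℝ)} (hγ : γ ∈ Γ) (h : SL(2, ℝ)) :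
    cuspVectors Γ g σ (γ * h) = cuspVectors Γ g σ h := by
  ext u
  constructor
  · rintro ⟨ℓ, δ, hδ, rfl⟩
    exact ⟨ℓ, δ * γ, Γ.mul_mem hδ hγ, by simp only [mul_assoc]⟩
  · rintro ⟨ℓ, δ, hδ, rfl⟩
    exact ⟨ℓ, δ * γ⁻¹, Γ.mul_mem hδ (Γ.inv_mem hγ), by simp [mul_assoc]⟩

lemma rowMul_smul (m : SL(2, ℝ)) (c : ℝ) (u : ℝ × ℝ) : rowMul m (c • u) = c • rowMul m u := by
  ext <;> simp [rowMul] <;> ring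

lemma rowMul_mul (m m' : SL(2, ℝ)) (u : ℝ × ℝ) : rowMul (m * m') u = rowMul m' (rowMul m u) := by
  ext <;> simp only [rowMul, mul_apply_two] <;> ring

lemma cuspVectors_mul_right (h m : SL(2, ℝ)) :
    cuspVectors Γ g σ (h * m) = rowMul m '' cuspVectors Γ g σ h := by
  ext u
  constructor
  · rintro ⟨ℓ, δ, hδ, rfl⟩
    exact ⟨_, ⟨ℓ, δ, hδ, rfl⟩, by rw [rowMul_smul, ← bottomRow_mul, mul_assoc (g ℓ * δ)]⟩
  · rintro ⟨_, ⟨ℓ, δ, hδ, rfl⟩, rfl⟩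
    exact ⟨ℓ, δ, hδ, by rw [rowMul_smul, ← bottomRow_mul, mul_assoc (g ℓ * δ)]⟩

lemma neg_mem_cuspVectors (hneg : (-1 : SL(2, ℝ)) ∈ Γ) {h : SL(2, ℝ)} {u : ℝ × ℝ}
    (hu : u ∈ cuspVectors Γ g σ h) : -u ∈ cuspVectors Γ g σ h := by
  obtain ⟨ℓ, δ, hδ, rfl⟩ := hu
  refine ⟨ℓ, -1 * δ, Γ.mul_mem hneg hδ, ?_⟩
  rw [← smul_neg]
  congr 1
  ext <;> simp [bottomRow]

lemma rowMul_lowerUni (r : ℝ) (u : ℝ × ℝ) : rowMul (lowerUni r) u = (u.1 + r * u.2, u.2) := by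
  ext <;> simp [rowMul]
  ring

lemma rowMul_diagExp (t : ℝ) (u : ℝ × ℝ) :
    rowMul (diagExp t) u = (u.1 * Real.exp (t / 2), u.2 * Real.exp (-t / 2)) := by
  ext <;> simp [rowMul]

/-! ### Local finiteness -/

/-- The conjugate of `n(1)` by any matrix with bottom row `w`. -/
def unipotent (w : ℝ × ℝ) : SL(2, ℝ) :=
  ⟨!![1 + w.1 * w.2, w.2 ^ 2; -w.1 ^ 2, 1 - w.1 * w.2], by
    rw [Matrix.det_fin_two_of]
    ring⟩

lemma conj_upperUni_one (m : SL(2, ℝ)) : m⁻¹ * upperUni 1 * m = unipotent (bottomRow m) := by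
  have hd := det_eq_one_two m
  rw [mul_assoc, inv_mul_eq_iff_eq_mul]
  apply ext_two <;> rw [mul_apply_two, mul_apply_two] <;> simp [unipotent, bottomRow]
  · linear_combination -(m 1 0) * hd
  · linear_combination -(m 1 1) * hd
  · ring
  · ring

/-- Matrices with bounded entries form a compact set, and a discrete subgroup meets every compact
set in finitely many elements. -/
lemma finite_discrete_inter_bounded (Γ : Subgroup SL(2, ℝ)) [DiscreteTopology Γ] (h : SL(2, ℝ))
    (C : ℝ) : {γ : Γ | ∀ i j, |(h⁻¹ * γ * h) i j| ≤ C}.Finite := by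
  have hK : IsCompact {a : SL(2, ℝ) | ∀ i j, |a i j| ≤ C} := by
    have h1 : IsCompact (univ.pi fun _ => univ.pi fun _ => Icc (-C) C : Set (Fin 2 → Fin 2 → ℝ)) :=
      isCompact_univ_pi fun _ => isCompact_univ_pi fun _ => isCompact_Icc
    have h2 := (Matrix.SpecialLinearGroup.isClosedEmbedding_val (n := Fin 2) (R := ℝ)).isCompact_preimage h1
    convert! h2 using 1
    ext a
    exact ⟨fun h i _ j _ => abs_le.1 (h i j), fun h i j => abs_le.2 (h i trivial j trivial)⟩
  have hK' : IsCompact ((fun a => h * a * h⁻¹) '' {a : SL(2, ℝ) | ∀ i j, |a i j| ≤ C}) :=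
    hK.image (by fun_prop)
  have := (Subgroup.tendsto_coe_cofinite_of_discrete Γ ⟨inferInstance⟩).eventually hK'.compl_mem_cocompact
  rw [Filter.eventually_cofinite] at this
  refine this.subset fun γ hγ => ?_
  simp only [mem_ofPred_eq, not_not]
  exact ⟨h⁻¹ * γ * h, hγ, by group⟩

lemma conj_upperUni_mem (hg : IsCuspSystem Γ g) (κ : Fin K) (m : ℤ) :
    (g κ)⁻¹ * upperUni m * g κ ∈ Γ :=
  ((hg.width_one κ _).2 ⟨m, Or.inl rfl⟩).1

/-- A vector `w = (0,1) g_ℓ γ h` determines the parabolic element `γ⁻¹ g_ℓ⁻¹ n(1) g_ℓ γ` of `Γ`,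
whose conjugate by `h` is `unipotent w`. Bounded `w` gives bounded entries, hence finitely many
group elements, and each of these comes from finitely many `w`. -/
lemma finite_cuspVectors_inter [DiscreteTopology Γ] (hg : IsCuspSystem Γ g) (h : SL(2, ℝ)) (C : ℝ) :
    {u ∈ cuspVectors Γ g σ h | |u.1| ≤ C ∧ |u.2| ≤ C}.Finite := by
  have key : ∀ (ℓ : Fin K) (C : ℝ),
      {w : ℝ × ℝ | (∃ γ ∈ Γ, w = bottomRow (g ℓ * γ * h)) ∧ |w.1| ≤ C ∧ |w.2| ≤ C}.Finite := by
    intro ℓ C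
    -- The entries of `unipotent w` are `1 ± w₁w₂`, `w₂²` and `-w₁²`, hence the bound `1 + C²`; the
    -- off-diagonal ones recover `w` up to signs.
    have hfin := ((finite_discrete_inter_bounded Γ h (1 + C ^ 2)).image
      (fun γ : Γ => h⁻¹ * (γ : SL(2, ℝ)) * h)).preimage' (f := unipotent) (by
        intro b _
        refine (((toFinite {√(-b 1 0), -√(-b 1 0)}).prod (toFinite {√(b 0 1), -√(b 0 1)}))).subset ?_
        rintro w rfl
        simp only [unipotent, mem_prod, mem_insert_iff, mem_singleton_iff]
        simp only [Matrix.of_apply, Matrix.cons_val', Matrix.cons_val_zero, Matrix.cons_val_one,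
          Matrix.cons_val_fin_one, neg_neg, Real.sqrt_sq_eq_abs]
        exact ⟨(abs_choice w.1).imp (by intro h; rw [h]) (by intro h; rw [h, neg_neg]),
          (abs_choice w.2).imp (by intro h; rw [h]) (by intro h; rw [h, neg_neg])⟩)
    refine hfin.subset ?_
    rintro w ⟨⟨γ, hγ, rfl⟩, h1, h2⟩
    have hC : 0 ≤ C := (abs_nonneg _).trans h1
    set w := bottomRow (g ℓ * γ * h) with hw
    refine ⟨⟨γ⁻¹ * ((g ℓ)⁻¹ * upperUni 1 * g ℓ) * γ,
      Γ.mul_mem (Γ.mul_mem (Γ.inv_mem hγ) (by simpa using conj_upperUni_mem hg ℓ 1)) hγ⟩, ?_, ?_⟩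
    · have he : h⁻¹ * (γ⁻¹ * ((g ℓ)⁻¹ * upperUni 1 * g ℓ) * γ) * h = unipotent w := by
        rw [hw, ← conj_upperUni_one]
        group
      have h11 : w.1 ^ 2 ≤ C ^ 2 := sq_le_sq' (abs_le.1 h1).1 (abs_le.1 h1).2
      have h22 : w.2 ^ 2 ≤ C ^ 2 := sq_le_sq' (abs_le.1 h2).1 (abs_le.1 h2).2
      intro i j
      simp only [he]
      have := sq_nonneg (w.1 + w.2)
      have := sq_nonneg (w.1 - w.2)
      rw [abs_le]
      fin_cases i <;> fin_cases j <;> simp [unipotent] <;> constructor <;> nlinarith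
    · simp only
      rw [hw, ← conj_upperUni_one]
      group
  have hfin : (⋃ ℓ : Fin K, (fun w : ℝ × ℝ => Real.exp (σ ℓ / 2) • w) ''
      {w : ℝ × ℝ | (∃ γ ∈ Γ, w = bottomRow (g ℓ * γ * h)) ∧
        |w.1| ≤ C / Real.exp (σ ℓ / 2) ∧ |w.2| ≤ C / Real.exp (σ ℓ / 2)}).Finite :=
    finite_iUnion fun ℓ => (key ℓ _).image _
  refine hfin.subset ?_
  rintro _ ⟨⟨ℓ, γ, hγ, rfl⟩, h1, h2⟩
  refine mem_iUnion.2 ⟨ℓ, _, ⟨⟨γ, hγ, rfl⟩, ?_, ?_⟩, rfl⟩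
  · rw [le_div_iff₀ (Real.exp_pos _), mul_comm]
    simpa [abs_mul] using h1
  · rw [le_div_iff₀ (Real.exp_pos _), mul_comm]
    simpa [abs_mul] using h2

/-! ### Return times -/

lemma pt_eq_pt {a b : SL(2, ℝ)} : pt Γ a = pt Γ b ↔ b * a⁻¹ ∈ Γ := by
  rw [pt, pt, Quotient.eq]
  exact QuotientGroup.rightRel_apply

/-- A matrix with bottom row `(0, y)`, `y > 0`, is `n(s) a(t)` with `y = e^{-t/2}`, and `t ≥ σ_κ`
becomes `e^{σ_κ/2} y ≤ 1`. -/
lemma pt_mem_totalSection (h : SL(2, ℝ)) :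
    pt Γ h ∈ totalSection Γ g σ 0 ↔ ∃ u ∈ cuspVectors Γ g σ h, u.1 = 0 ∧ 0 < u.2 ∧ u.2 ≤ 1 := by
  have h1 : pt Γ h ∈ totalSection Γ g σ 0 ↔
      ∃ κ, ∃ t, σ κ ≤ t ∧ ∃ s, pt Γ ((g κ)⁻¹ * upperUni s * diagExp t) = pt Γ h := by
    simp only [totalSection, cuspSection, closedHorocycle, mem_iUnion, mem_image, mem_range, add_zero,
      mem_Ici, exists_prop, exists_exists_eq_and]
    rfl
  rw [h1]
  constructor
  · rintro ⟨κ, t, ht, s, hs⟩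
    rw [pt_eq_pt] at hs
    refine ⟨_, ⟨κ, _, Γ.inv_mem hs, rfl⟩, ?_⟩
    rw [show g κ * (h * ((g κ)⁻¹ * upperUni s * diagExp t)⁻¹)⁻¹ * h = upperUni s * diagExp t by group]
    have hb : bottomRow (upperUni s * diagExp t) = (0, Real.exp (-t / 2)) := by
      ext <;> simp [bottomRow]
    rw [hb]
    refine ⟨by simp, by simp; positivity, ?_⟩
    simp only [Prod.smul_mk, smul_eq_mul]
    rw [← Real.exp_add, Real.exp_le_one_iff]
    linarith
  · rintro ⟨_, ⟨κ, γ, hγ, rfl⟩, h1, h2, h3⟩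
    simp only [Prod.smul_fst, Prod.smul_snd, smul_eq_mul, bottomRow_one_zero, bottomRow_one_one] at h1 h2 h3
    set m := g κ * γ * h with hm
    have he := Real.exp_pos (σ κ / 2)
    have hm0 : m 1 0 = 0 := by simpa [he.ne'] using h1
    have hm1 : 0 < m 1 1 := by
      rcases (pos_iff_pos_of_mul_pos h2) with ⟨h, _⟩
      exact h he
    have hd := det_eq_one_two m
    rw [hm0, mul_zero, sub_zero] at hd
    refine ⟨κ, -2 * Real.log (m 1 1), ?_, m 0 1 / m 1 1, ?_⟩
    · have := Real.log_le_log h2 h3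
      rw [Real.log_one, Real.log_mul he.ne' hm1.ne', Real.log_exp] at this
      linarith
    · rw [pt_eq_pt]
      have : upperUni (m 0 1 / m 1 1) * diagExp (-2 * Real.log (m 1 1)) = m := by
        have e1 : Real.exp (-2 * Real.log (m 1 1) / 2) = m 0 0 := by
          rw [show -2 * Real.log (m 1 1) / 2 = -Real.log (m 1 1) by ring, Real.exp_neg,
            Real.exp_log hm1]
          field_simp
          linarith
        have e2 : Real.exp (-(-2 * Real.log (m 1 1)) / 2) = m 1 1 := by
          rw [show -(-2 * Real.log (m 1 1)) / 2 = Real.log (m 1 1) by ring, Real.exp_log hm1]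
        apply ext_two <;> rw [mul_apply_two] <;>
          simp only [upperUni_coe, diagExp_coe, e1, e2] <;> simp
        · field_simp
        · exact hm0.symm
      rw [mul_assoc, this, hm]
      have : h * ((g κ)⁻¹ * (g κ * γ * h))⁻¹ = γ⁻¹ := by group
      rw [this]
      exact Γ.inv_mem hγ

/-- The group element over the point `ι(s, t, κ)` of the section. -/
def sectionPoint (g : Fin K → SL(2, ℝ)) (s t : ℝ) (κ : Fin K) : SL(2, ℝ) :=
  (g κ)⁻¹ * upperUni s * diagExp t

lemma unstableFlow_embed_mem (r s t : ℝ) (κ : Fin K) :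
    unstableFlow Γ r (embed Γ g s t κ) ∈ totalSection Γ g σ 0 ↔
      ∃ u ∈ cuspVectors Γ g σ (sectionPoint g s t κ), u.1 = r * u.2 ∧ 0 < u.2 ∧ u.2 ≤ 1 := by
  have : unstableFlow Γ r (embed Γ g s t κ) = pt Γ (sectionPoint g s t κ * lowerUni (-r)) := rfl
  rw [this, pt_mem_totalSection, cuspVectors_mul_right]
  simp only [exists_mem_image, rowMul_lowerUni]
  refine exists_congr fun u => and_congr_right fun _ => and_congr_left fun _ => ?_
  constructor <;> intro h <;> linarith

/-- Local finiteness makes the infimum a minimum when there are hits, so a strict inequality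
excludes hits on the closed interval up to `r`. -/
lemma ofReal_lt_iInf_iff {P : ℝ → Prop} (hP : ∀ R, {r | P r ∧ 0 < r ∧ r ≤ R}.Finite) {r : ℝ}
    (hr : 0 ≤ r) :
    ENNReal.ofReal r < (⨅ (r' : ℝ) (_ : 0 < r') (_ : P r'), ENNReal.ofReal r') ↔
      ∀ r', 0 < r' → r' ≤ r → ¬ P r' := by
  constructor
  · intro h r' h0 h1 hp
    have : (⨅ (r' : ℝ) (_ : 0 < r') (_ : P r'), ENNReal.ofReal r') ≤ ENNReal.ofReal r' :=
      iInf_le_of_le r' (iInf_le_of_le h0 (iInf_le_of_le hp le_rfl))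
    exact absurd (h.trans_le (this.trans (ENNReal.ofReal_le_ofReal h1))) (lt_irrefl _)
  · intro h
    -- Take the least hit up to `r + 1`, or `r + 1` itself if there is none.
    obtain ⟨b, hb, hb'⟩ : ∃ b, r < b ∧ ∀ r', 0 < r' → P r' → b ≤ r' := by
      rcases ({r' | P r' ∧ 0 < r' ∧ r' ≤ r + 1}).eq_empty_or_nonempty with he | hne
      · refine ⟨r + 1, by linarith, fun r' h0 hp => ?_⟩
        by_contra! hlt
        exact eq_empty_iff_forall_notMem.1 he r' ⟨hp, h0, hlt.le⟩
      · obtain ⟨b, ⟨hbP, hb0, hb1⟩, hmin⟩ := exists_min_image _ id (hP (r + 1)) hne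
        refine ⟨b, ?_, fun r' h0 hp => ?_⟩
        · by_contra! hle
          exact h b hb0 hle hbP
        · by_contra! hlt
          exact absurd (hmin r' ⟨hp, h0, by linarith⟩) (not_le.2 hlt)
    refine lt_of_lt_of_le ((ENNReal.ofReal_lt_ofReal_iff (hr.trans_lt hb)).2 hb) ?_
    exact le_iInf fun r' => le_iInf fun h0 => le_iInf fun hp => ENNReal.ofReal_le_ofReal (hb' r' h0 hp)

lemma finite_hits [DiscreteTopology Γ] (hg : IsCuspSystem Γ g) (h : SL(2, ℝ)) (R : ℝ) :
    {r : ℝ | (∃ u ∈ cuspVectors Γ g σ h, u.1 = r * u.2 ∧ 0 < u.2 ∧ u.2 ≤ 1) ∧ |r| ≤ R}.Finite := by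
  refine ((finite_cuspVectors_inter (σ := σ) hg h (max R 1)).image fun u => u.1 / u.2).subset ?_
  rintro r ⟨⟨u, hu, h1, h2, h3⟩, h4⟩
  refine ⟨u, ⟨hu, ?_, ?_⟩, ?_⟩
  · rw [h1, abs_mul, abs_of_pos h2]
    exact le_max_of_le_left ((mul_le_of_le_one_right (abs_nonneg r) h3).trans h4)
  · rw [abs_of_pos h2]
    exact le_max_of_le_right h3
  · simp only [h1]
    field_simp

lemma ofReal_lt_returnTime_iff [DiscreteTopology Γ] (hg : IsCuspSystem Γ g) {r : ℝ} (hr : 0 ≤ r)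
    (s t : ℝ) (κ : Fin K) :
    ENNReal.ofReal r < returnTime Γ g σ s t κ ↔
      ∀ u ∈ cuspVectors Γ g σ (sectionPoint g s t κ), 0 < u.2 → u.2 ≤ 1 → 0 < u.1 → r * u.2 < u.1 := by
  rw [returnTime, ofReal_lt_iInf_iff (fun R => ?_) hr]
  · simp only [unstableFlow_embed_mem]
    constructor
    · intro h u hu h1 h2 h3
      by_contra! hle
      exact h (u.1 / u.2) (by positivity) ((div_le_iff₀ h1).2 hle)
        ⟨u, hu, by field_simp, h1, h2⟩
    · rintro h r' h0 h1 ⟨u, hu, h2, h3, h4⟩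
      have := h u hu h3 h4 (h2 ▸ by positivity)
      rw [h2] at this
      exact absurd (lt_of_mul_lt_mul_right this h3.le) (not_lt.2 h1)
  · simp only [unstableFlow_embed_mem]
    refine (finite_hits (σ := σ) hg (sectionPoint g s t κ) R).subset ?_
    rintro r ⟨h1, h2, h3⟩
    exact ⟨h1, by rwa [abs_of_pos h2]⟩

lemma ofReal_lt_backReturnTime_iff [DiscreteTopology Γ] (hg : IsCuspSystem Γ g) {r : ℝ} (hr : 0 ≤ r)
    (s t : ℝ) (κ : Fin K) :
    ENNReal.ofReal r < backReturnTime Γ g σ s t κ ↔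
      ∀ u ∈ cuspVectors Γ g σ (sectionPoint g s t κ), 0 < u.2 → u.2 ≤ 1 → u.1 < 0 → u.1 < -r * u.2 := by
  rw [backReturnTime, ofReal_lt_iInf_iff (fun R => ?_) hr]
  · simp only [unstableFlow_embed_mem]
    constructor
    · intro h u hu h1 h2 h3
      by_contra! hle
      refine h (-u.1 / u.2) (div_pos (by linarith) h1) ((div_le_iff₀ h1).2 (by linarith))
        ⟨u, hu, by field_simp, h1, h2⟩
    · rintro h r' h0 h1 ⟨u, hu, h2, h3, h4⟩
      have := h u hu h3 h4 (by rw [h2]; nlinarith)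
      rw [h2] at this
      have := lt_of_mul_lt_mul_right this h3.le
      linarith
  · simp only [unstableFlow_embed_mem]
    refine ((finite_hits (σ := σ) hg (sectionPoint g s t κ) R).image Neg.neg).subset ?_
    rintro r ⟨h1, h2, h3⟩
    exact ⟨-r, ⟨h1, by rwa [abs_neg, abs_of_pos h2]⟩, neg_neg r⟩

lemma density_eq_prod [DiscreteTopology Γ] (hg : IsCuspSystem Γ g) {r : ℝ} (hr : 0 ≤ r)
    (s t : ℝ) (κ : Fin K) :
    density Γ g σ r s t κ =
      1 / (meanReturnTime Γ g σ).toReal * ∏ ℓ : Fin K,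
        emptyIndicator (scaledSet (Real.exp (σ ℓ / 2)) (cuspOrbit Γ g ℓ)
          ((g κ)⁻¹ * upperUni s * diagExp t) ∩ negTriangle r) := by
  classical
  suffices key : ENNReal.ofReal r < backReturnTime Γ g σ s t κ ↔
      ∀ ℓ : Fin K, scaledSet (Real.exp (σ ℓ / 2)) (cuspOrbit Γ g ℓ)
        ((g κ)⁻¹ * upperUni s * diagExp t) ∩ negTriangle r = ∅ by
    rw [density, if_congr key rfl rfl]
    congr 1
    split_ifs with h
    · exact (Finset.prod_eq_one fun ℓ _ => if_pos (h ℓ)).symm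
    · obtain ⟨ℓ, hℓ⟩ := not_forall.1 h
      exact (Finset.prod_eq_zero (Finset.mem_univ ℓ) (if_neg hℓ)).symm
  rw [ofReal_lt_backReturnTime_iff hg hr]
  simp only [eq_empty_iff_forall_notMem]
  have hcoe : ∀ (ℓ : Fin K) (γ : SL(2, ℝ)) (i : Fin 2),
      (Real.exp (σ ℓ / 2) • Matrix.vecMul (Matrix.vecMul ![0, 1] (g ℓ * γ).1)
        ((g κ)⁻¹ * upperUni s * diagExp t).1) i =
      Real.exp (σ ℓ / 2) * (g ℓ * γ * sectionPoint g s t κ) 1 i := by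
    intro ℓ γ i
    rw [Matrix.vecMul_vecMul, mul_apply_two, sectionPoint]
    simp [Matrix.vecMul, dotProduct, Matrix.mul_apply, Fin.sum_univ_two]
  constructor
  · rintro h ℓ _ ⟨⟨_, ⟨γ, hγ, rfl⟩, rfl⟩, h1, h2, h3, h4⟩
    simp only [hcoe] at h1 h2 h3 h4
    have := h _ ⟨ℓ, γ, hγ, rfl⟩ h3 h4 h2
    exact absurd this (not_lt.2 h1)
  · rintro h _ ⟨ℓ, γ, hγ, rfl⟩ h1 h2 h3
    by_contra! hle
    refine h ℓ _ ⟨⟨_, ⟨γ, hγ, rfl⟩, rfl⟩, ?_⟩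
    simp only [negTriangle, mem_ofPred_eq, hcoe]
    exact ⟨hle, h3, h1, h2⟩

/-! ### A fundamental domain lifted from the upper half-plane -/

lemma countable_of_discrete (Γ : Subgroup SL(2, ℝ)) [DiscreteTopology Γ] : Countable Γ := by
  have : SecondCountableTopology (Matrix (Fin 2) (Fin 2) ℝ) :=
    inferInstanceAs (SecondCountableTopology (Fin 2 → Fin 2 → ℝ))
  have : SecondCountableTopology SL(2, ℝ) :=
    (Matrix.SpecialLinearGroup.isClosedEmbedding_val (n := Fin 2)
      (R := ℝ)).isEmbedding.secondCountableTopology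
  exact TopologicalSpace.separableSpace_iff_countable.1 inferInstance

instance instMeasurableConstSMulSL : MeasurableConstSMul Γ SL(2, ℝ) :=
  ⟨fun γ => measurable_SL_mul_left γ⟩

instance instSMulInvariantMeasureSL : SMulInvariantMeasure Γ SL(2, ℝ) haarSL :=
  ⟨fun γ _ hs => (measurePreserving_mul_left (γ : SL(2, ℝ))).measure_preimage hs.nullMeasurableSet⟩

lemma ae_entry_ne_zero (a : SL(2, ℝ)) : ∀ᵐ h ∂haarSL, (a * h) 1 1 ≠ 0 := by
  have h1 : ∀ᵐ h ∂haarSL, h 1 1 ≠ 0 := by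
    refine (ae_map_iff measurable_frame.aemeasurable
      (measurable_entry 1 1 (measurableSet_singleton 0).compl)).2 ?_
    have h2 : ∀ᵐ p : (ℝ × ℝ) × ℝ, p.1.2 ≠ 0 := by
      simp_rw [Measure.volume_eq_prod]
      exact (Measure.quasiMeasurePreserving_snd.comp Measure.quasiMeasurePreserving_fst).ae
        (Measure.ae_ne volume 0)
    filter_upwards [h2] with p hp
    have : p.1 ≠ 0 := fun h => hp (by rw [h]; rfl)
    rw [frame_coe this]
    exact hp
  exact (measurePreserving_mul_left a).quasiMeasurePreserving.ae h1

lemma quasiMeasurePreserving_smul_I :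
    Measure.QuasiMeasurePreserving (fun h : SL(2, ℝ) => h • UpperHalfPlane.I) haarSL volume :=
  ⟨measurable_SL_smul_I, by
    rw [map_smul_I_haarSL]
    exact Measure.smul_absolutelyContinuous⟩

lemma eq_one_or_eq_neg_one_of_smul {a : SL(2, ℝ)} (ha : ∀ z : ℍ, a • z = z) : a = 1 ∨ a = -1 := by
  obtain ⟨h1, h2⟩ := (smul_I_eq_I_iff a).1 (ha UpperHalfPlane.I)
  have h3 := congrArg UpperHalfPlane.coe (ha (upPt 0 2))
  rw [UpperHalfPlane.coe_specialLinearGroup_apply, upPt_coe two_pos, div_eq_iff, Complex.ext_iff] at h3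
  · simp at h3
    have h10 : a 1 0 = 0 := by linarith [h3.1]
    have hd := det_eq_one_two a
    have h01 : a 0 1 = 0 := by rw [h2, h10, neg_zero]
    rw [h1, h10, mul_zero, sub_zero] at hd
    rcases mul_self_eq_one_iff.1 hd with h | h
    · exact Or.inl (ext_two (by simp [h1, h]) (by simp [h01]) (by simp [h10]) (by simp [h]))
    · exact Or.inr (ext_two (by simp [h1, h]) (by simp [h01]) (by simp [h10]) (by simp [h]))
  · rw [← upPt_coe two_pos]
    exact UpperHalfPlane.denom_ne_zero (a : GL (Fin 2) ℝ) (upPt 0 2)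

lemma neg_SL_smul (h : SL(2, ℝ)) (z : ℍ) : (-h) • z = h • z := by
  apply UpperHalfPlane.ext
  simp only [UpperHalfPlane.coe_specialLinearGroup_apply]
  simp
  rw [← neg_div_neg_eq]
  ring_nf

/-- The matrices over `F` whose lower right entry is positive. -/
def halfLift (F : Set ℍ) : Set SL(2, ℝ) := {h | h • UpperHalfPlane.I ∈ F ∧ 0 < h 1 1}

/-- The action on `ℍ` does not see `±1`; the sign of the lower right entry, nonzero almost
everywhere, selects one of `h` and `-h`. -/
lemma isFundamentalDomain_halfLift [DiscreteTopology Γ] (hneg : (-1 : SL(2, ℝ)) ∈ Γ) {F : Set ℍ}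
    (hF : IsFundDomain Γ F) : IsFundamentalDomain Γ (halfLift F) haarSL := by
  have := countable_of_discrete Γ
  refine IsFundamentalDomain.mk'' ?_ ?_ ?_
    fun γ => (measurePreserving_mul_left (γ : SL(2, ℝ))).quasiMeasurePreserving
  · exact (hF.nullMeasurableSet.preimage quasiMeasurePreserving_smul_I).inter
      (measurable_entry 1 1 measurableSet_Ioi).nullMeasurableSet
  · filter_upwards [quasiMeasurePreserving_smul_I.ae hF.ae_covers,
      ae_all_iff.2 fun γ : Γ => ae_entry_ne_zero (γ : SL(2, ℝ))] with h ⟨⟨_, γ, hγ, rfl⟩, h1⟩ h2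
    have h3 : (γ * h) • UpperHalfPlane.I ∈ F := by rw [mul_smul]; exact h1
    rcases (h2 ⟨γ, hγ⟩).lt_or_gt with h4 | h4
    · refine ⟨⟨-1 * γ, Γ.mul_mem hneg hγ⟩, ?_, ?_⟩
      · change (-1 * γ * h) • UpperHalfPlane.I ∈ F
        rwa [neg_one_mul, neg_mul, neg_SL_smul]
      · change 0 < (-1 * γ * h) 1 1
        rw [neg_one_mul, neg_mul]
        simpa using h4
    · exact ⟨⟨γ, hγ⟩, h3, h4⟩
  · intro γ hγ
    by_cases hp : MulAction.toPermHom SL(2, ℝ) ℍ γ = 1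
    · have h1 : (γ : SL(2, ℝ)) = -1 := by
        refine (eq_one_or_eq_neg_one_of_smul fun z => ?_).resolve_left fun h => hγ (Subtype.ext h)
        exact congrArg (fun e : Equiv.Perm ℍ => e z) hp
      refine Disjoint.aedisjoint (disjoint_left.2 ?_)
      rintro _ ⟨h, hh, rfl⟩ hh'
      have h2 : 0 < ((γ : SL(2, ℝ)) * h) 1 1 := hh'.2
      rw [h1, neg_one_mul] at h2
      have h3 := hh.2
      simp at h2
      linarith
    · have h1 := hF.aedisjoint (i := ⟨_, mem_image_of_mem _ γ.2⟩) (j := 1)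
        fun h => hp (congrArg Subtype.val h)
      have h2 := quasiMeasurePreserving_smul_I.preimage_null h1
      refine measure_mono_null ?_ h2
      rintro _ ⟨⟨h, hh, rfl⟩, hh'⟩
      refine ⟨⟨h • UpperHalfPlane.I, hh.1, ?_⟩, ⟨_, hh'.1, one_smul _ _⟩⟩
      exact (mul_smul (γ : SL(2, ℝ)) h UpperHalfPlane.I).symm

lemma two_mul_haarSL_halfLift {F : Set ℍ} (hF : NullMeasurableSet F) :
    2 * haarSL (halfLift F) = ENNReal.ofReal Real.pi * volume F := by
  have h1 : haarSL ((fun h : SL(2, ℝ) => h • UpperHalfPlane.I) ⁻¹' F) =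
      ENNReal.ofReal Real.pi * volume F := by
    rw [← Measure.map_apply₀ measurable_SL_smul_I.aemeasurable
      (hF.mono_ac quasiMeasurePreserving_smul_I.absolutelyContinuous), map_smul_I_haarSL]
    rfl
  have hnm : NullMeasurableSet (halfLift F) haarSL :=
    (hF.preimage quasiMeasurePreserving_smul_I).inter
      (measurable_entry 1 1 measurableSet_Ioi).nullMeasurableSet
  have hmp := measurePreserving_mul_left (-1)
  have h2 : haarSL ((fun h => -1 * h) ⁻¹' halfLift F) = haarSL (halfLift F) :=
    hmp.measure_preimage hnm
  have hdisj : Disjoint ((fun h => -1 * h) ⁻¹' halfLift F) (halfLift F) := by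
    refine disjoint_left.2 fun h hh hh' => ?_
    have h3 := hh.2
    have h4 := hh'.2
    simp at h3
    linarith
  rw [two_mul, ← h1]
  nth_rewrite 1 [← h2]
  rw [← measure_union₀ hnm hdisj.aedisjoint]
  refine measure_congr ?_
  filter_upwards [ae_entry_ne_zero 1] with h hh
  rw [one_mul] at hh
  refine propext ⟨?_, fun h3 => ?_⟩
  · rintro (h3 | h3)
    · have h4 : (-1 * h) • UpperHalfPlane.I ∈ F := h3.1
      rwa [neg_one_mul, neg_SL_smul] at h4
    · exact h3.1
  · rcases hh.lt_or_gt with h4 | h4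
    · refine Or.inl ⟨?_, ?_⟩
      · change (-1 * h) • UpperHalfPlane.I ∈ F
        rwa [neg_one_mul, neg_SL_smul]
      · simpa using h4
    · exact Or.inr ⟨h3, h4⟩

/-! ### Almost every orbit meets the section in the past -/

/-- The matrices `h` none of whose cusp vectors lies in `S`. -/
def avoiding (Γ : Subgroup SL(2, ℝ)) {K : ℕ} (g : Fin K → SL(2, ℝ)) (σ : Fin K → ℝ)
    (S : Set (ℝ × ℝ)) : Set SL(2, ℝ) :=
  {h | ∀ u ∈ cuspVectors Γ g σ h, u ∉ S}

lemma measurable_cuspVector (ℓ : Fin K) (γ : SL(2, ℝ)) :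
    Measurable fun h => Real.exp (σ ℓ / 2) • bottomRow (g ℓ * γ * h) :=
  Measurable.const_smul (g := fun h => bottomRow (g ℓ * γ * h))
    (measurable_bottomRow.comp (measurable_SL_mul_left (g ℓ * γ))) (Real.exp (σ ℓ / 2))

lemma measurableSet_avoiding [Countable Γ] {S : Set (ℝ × ℝ)} (hS : MeasurableSet S) :
    MeasurableSet (avoiding Γ g σ S) := by
  have : avoiding Γ g σ S = ⋂ (ℓ : Fin K) (γ : Γ),
      (fun h => Real.exp (σ ℓ / 2) • bottomRow (g ℓ * γ * h)) ⁻¹' Sᶜ := by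
    ext h
    simp only [mem_iInter]
    constructor
    · intro hh ℓ γ
      exact hh _ ⟨ℓ, γ, γ.2, rfl⟩
    · rintro hh _ ⟨ℓ, γ, hγ, rfl⟩
      exact hh ℓ ⟨γ, hγ⟩
  rw [this]
  exact MeasurableSet.iInter fun ℓ => MeasurableSet.iInter fun γ =>
    measurable_cuspVector ℓ _ hS.compl

lemma preimage_smul_avoiding (γ : Γ) (S : Set (ℝ × ℝ)) :
    (fun h : SL(2, ℝ) => γ • h) ⁻¹' avoiding Γ g σ S = avoiding Γ g σ S := by
  ext h
  change (∀ u ∈ cuspVectors Γ g σ ((γ : SL(2, ℝ)) * h), u ∉ S) ↔ _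
  rw [cuspVectors_mul_left γ.2]
  rfl

lemma preimage_mul_right_avoiding (m : SL(2, ℝ)) (S : Set (ℝ × ℝ)) :
    (fun h => h * m) ⁻¹' avoiding Γ g σ S = avoiding Γ g σ (rowMul m ⁻¹' S) := by
  ext h
  change (∀ u ∈ cuspVectors Γ g σ (h * m), u ∉ S) ↔ _
  rw [cuspVectors_mul_right, forall_mem_image]
  rfl

/-- A right translate of `D` is again a fundamental domain, and a `Γ`-invariant set has the same
mass in any two of them. -/
lemma haarSL_avoiding_preimage [Countable Γ] {D : Set SL(2, ℝ)}
    (hD : IsFundamentalDomain Γ D haarSL) {S : Set (ℝ × ℝ)} (hS : MeasurableSet S) (m : SL(2, ℝ)) :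
    haarSL (avoiding Γ g σ (rowMul m ⁻¹' S) ∩ D) = haarSL (avoiding Γ g σ S ∩ D) := by
  have hA := measurableSet_avoiding (Γ := Γ) (g := g) (σ := σ) hS
  have hD' : IsFundamentalDomain Γ ((fun h => h * m⁻¹) ⁻¹' D) haarSL :=
    hD.preimage_of_equiv (measurePreserving_mul_right m⁻¹).quasiMeasurePreserving
      (e := id) Function.bijective_id fun γ h => mul_assoc (γ : SL(2, ℝ)) h m⁻¹
  rw [hD.measure_set_eq hD' hA fun γ => preimage_smul_avoiding γ S,
    ← (measurePreserving_mul_right m).measure_preimage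
      (hA.nullMeasurableSet.inter hD'.nullMeasurableSet), preimage_inter,
    preimage_mul_right_avoiding, ← preimage_comp]
  congr 2
  simp [Function.comp_def]

/-- Almost every unstable horocycle meets the section in the past. -/
lemma ae_exists_cuspVector [Countable Γ] (hneg : (-1 : SL(2, ℝ)) ∈ Γ) (hK : 0 < K)
    {D : Set SL(2, ℝ)} (hD : IsFundamentalDomain Γ D haarSL) (hfin : haarSL D ≠ ⊤) :
    ∀ᵐ h ∂haarSL, ∃ u ∈ cuspVectors Γ g σ h, 0 < u.2 ∧ u.2 ≤ 1 ∧ u.1 ≤ 0 := by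
  let S : Set (ℝ × ℝ) := {u | 0 < u.2 ∧ u.2 ≤ 1 ∧ u.1 ≤ 0}
  -- The sets `T n` exhaust the half-plane `u₂ > 0`, yet each is the preimage of `S = T 0` under
  -- some `rowMul m`. So the sets avoiding `T n` decrease within `D` while keeping constant mass,
  -- and finiteness of `haarSL D` equates this mass with that of the limit.
  let T : ℕ → Set (ℝ × ℝ) := fun n => {u | 0 < u.2 ∧ u.2 ≤ n + 1 ∧ u.1 ≤ n * u.2}
  have hS : MeasurableSet S :=
    (measurableSet_lt measurable_const measurable_snd).inter
      ((measurableSet_le measurable_snd measurable_const).inter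
        (measurableSet_le measurable_fst measurable_const))
  let m : ℕ → SL(2, ℝ) := fun n => lowerUni (-n) * diagExp (2 * Real.log (n + 1))
  have hT : ∀ n, T n = rowMul (m n) ⁻¹' S := by
    intro n
    have hn : (0 : ℝ) < n + 1 := by positivity
    ext u
    simp only [T, S, m, mem_preimage, rowMul_mul, rowMul_lowerUni, rowMul_diagExp, mem_ofPred_eq]
    rw [show 2 * Real.log (n + 1) / 2 = Real.log (n + 1 : ℝ) by ring,
      show -(2 * Real.log (n + 1)) / 2 = -Real.log (n + 1 : ℝ) by ring, Real.exp_neg,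
      Real.exp_log hn]
    refine and_congr ?_ (and_congr ?_ ?_)
    · rw [mul_pos_iff_of_pos_right (inv_pos.2 hn)]
    · rw [← div_eq_mul_inv, div_le_one hn]
    · rw [← not_lt, ← not_lt, mul_pos_iff_of_pos_right hn, not_lt, not_lt]
      constructor <;> intro h <;> linarith
  have hTm : ∀ n, MeasurableSet (T n) := fun n => by
    rw [hT]
    exact (measurePreserving_rowMul _).measurable hS
  have hconst : ∀ n, haarSL (avoiding Γ g σ (T n) ∩ D) = haarSL (avoiding Γ g σ S ∩ D) := fun n => by
    rw [hT]
    exact haarSL_avoiding_preimage hD hS _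
  have hmono : Antitone fun n => avoiding Γ g σ (T n) ∩ D := by
    intro a b hab
    refine inter_subset_inter_left _ fun h hh u hu hua => hh u hu ?_
    have hab' : (a : ℝ) ≤ b := Nat.cast_le.2 hab
    exact ⟨hua.1, hua.2.1.trans (by linarith),
      hua.2.2.trans (mul_le_mul_of_nonneg_right hab' hua.1.le)⟩
  have hlim := tendsto_measure_iInter_atTop (μ := haarSL)
    (fun n => (measurableSet_avoiding (Γ := Γ) (g := g) (σ := σ) (hTm n)).nullMeasurableSet.inter
      hD.nullMeasurableSet) hmono ⟨0, measure_ne_top_of_subset inter_subset_right hfin⟩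
  -- In the limit no cusp vector has `u₂ > 0`; by the symmetry `u ↦ -u` all have `u₂ = 0`, which is
  -- already a null condition for one vector.
  have hzero : haarSL (⋂ n, avoiding Γ g σ (T n) ∩ D) = 0 := by
    refine measure_mono_null (t := {h | ¬ (g ⟨0, hK⟩ * h) 1 1 ≠ 0}) ?_ (ae_entry_ne_zero _)
    intro h hh h0
    have key : ∀ u ∈ cuspVectors Γ g σ h, ¬ 0 < u.2 := by
      intro u hu hpos
      obtain ⟨n, hn⟩ := exists_nat_ge (max u.2 (u.1 / u.2))
      refine (mem_iInter.1 hh n).1 u hu ⟨hpos, ?_, ?_⟩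
      · linarith [le_max_left u.2 (u.1 / u.2)]
      · exact (div_le_iff₀ hpos).1 ((le_max_right _ _).trans hn)
    have hmem : Real.exp (σ ⟨0, hK⟩ / 2) • bottomRow (g ⟨0, hK⟩ * 1 * h) ∈ cuspVectors Γ g σ h :=
      ⟨_, 1, Γ.one_mem, rfl⟩
    have h1 := key _ hmem
    have h2 := key _ (neg_mem_cuspVectors hneg hmem)
    simp only [mul_one, Prod.smul_snd, Prod.snd_neg, smul_eq_mul, bottomRow_one_one] at h1 h2
    have he := Real.exp_pos (σ ⟨0, hK⟩ / 2)
    rcases h0.lt_or_gt with h3 | h3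
    · exact h2 (by nlinarith)
    · exact h1 (by positivity)
  have hA0 : haarSL (avoiding Γ g σ S ∩ D) = 0 := by
    rw [hzero] at hlim
    simp only [Function.comp_def, hconst] at hlim
    exact tendsto_nhds_unique tendsto_const_nhds hlim
  have hA : haarSL (avoiding Γ g σ S) = 0 := by
    refine hD.measure_zero_of_invariant _ (fun γ => ?_) hA0
    rw [← preimage_smul_inv]
    exact preimage_smul_avoiding γ⁻¹ S
  refine measure_mono_null (fun h hh => ?_) hA
  intro u hu huS
  exact hh ⟨u, hu, huS⟩

/-! ### Haar measure in horocyclic coordinates and flow box volumes -/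

/-- The matrix `n(x) a(t) n⁻(-r)`. -/
def horoCoord (x t r : ℝ) : SL(2, ℝ) := upperUni x * diagExp t * lowerUni (-r)

lemma measurable_horoCoord : Measurable fun p : ℝ × ℝ × ℝ => horoCoord p.1 p.2.1 p.2.2 := by
  refine measurable_SL_iff.2 fun i j => ?_
  simp only [horoCoord, mul_apply_two]
  fin_cases i <;> fin_cases j <;> simp <;> fun_prop

lemma measurable_horoCoord_slice (t : ℝ) : Measurable fun p : ℝ × ℝ => horoCoord p.1 t p.2 := by
  refine measurable_SL_iff.2 fun i j => ?_
  simp only [horoCoord, mul_apply_two]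
  fin_cases i <;> fin_cases j <;> simp <;> fun_prop

lemma frame_eq_horoCoord (x t r : ℝ) :
    frame (-(r * Real.exp (-t / 2)), Real.exp (-t / 2))
      (x + -(r * Real.exp (-t / 2)) / (((-(r * Real.exp (-t / 2))) ^ 2 + Real.exp (-t / 2) ^ 2) *
        Real.exp (-t / 2))) = horoCoord x t r := by
  have hw := Real.exp_pos (-t / 2)
  have hinv : Real.exp (t / 2) = 1 / Real.exp (-t / 2) := by
    rw [neg_div, Real.exp_neg, one_div, inv_inv]
  have hne : ((-(r * Real.exp (-t / 2)), Real.exp (-t / 2)) : ℝ × ℝ) ≠ 0 := fun h =>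
    hw.ne' (congrArg Prod.snd h)
  have hN : (-(r * Real.exp (-t / 2))) ^ 2 + Real.exp (-t / 2) ^ 2 ≠ 0 := by positivity
  rw [horoCoord]
  apply ext_two <;> rw [frame_coe hne] <;> simp only [mul_apply_two, frameMatrix] <;>
    simp [hinv] <;> field_simp <;> ring

lemma lintegral_eq_scale {w : ℝ} (hw : 0 < w) (F : ℝ → ℝ≥0∞) :
    ∫⁻ y : ℝ, F y = ENNReal.ofReal w * ∫⁻ r : ℝ, F (-(r * w)) := by
  have himg : (fun r : ℝ => -(r * w)) '' univ = univ := by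
    rw [image_univ]
    exact Function.Surjective.range_eq fun y => ⟨-y / w, by field_simp⟩
  have hd : ∀ r ∈ univ, HasDerivWithinAt (fun r : ℝ => -(r * w)) (-w) univ r := fun r _ =>
    HasDerivAt.hasDerivWithinAt (hasDerivAt_mul_const w).neg
  have := lintegral_image_eq_lintegral_abs_deriv_mul MeasurableSet.univ hd
    (fun a _ b _ hab => mul_right_cancel₀ hw.ne' (neg_injective hab)) F
  rw [himg] at this
  simp only [Measure.restrict_univ, abs_neg, abs_of_pos hw] at this
  rw [this, lintegral_const_mul' _ _ ENNReal.ofReal_ne_top]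

lemma lintegral_Ioi_exp (F : ℝ → ℝ≥0∞) : ∫⁻ w in Ioi (0 : ℝ), F w =
    ∫⁻ t : ℝ, ENNReal.ofReal (Real.exp (-t / 2) / 2) * F (Real.exp (-t / 2)) := by
  have himg : (fun t : ℝ => Real.exp (-t / 2)) '' univ = Ioi 0 := by
    rw [image_univ]
    ext y
    constructor
    · rintro ⟨t, rfl⟩
      exact Real.exp_pos _
    · intro hy
      refine ⟨-2 * Real.log y, ?_⟩
      change Real.exp (-(-2 * Real.log y) / 2) = y
      rw [show -(-2 * Real.log y) / 2 = Real.log y by ring, Real.exp_log hy]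
  have hd : ∀ t ∈ univ, HasDerivWithinAt (fun t : ℝ => Real.exp (-t / 2))
      (Real.exp (-t / 2) * (-1 / 2)) univ t := fun t _ =>
    (((hasDerivAt_id t).neg.div_const 2).exp).hasDerivWithinAt
  have := lintegral_image_eq_lintegral_abs_deriv_mul MeasurableSet.univ hd
    (fun a _ b _ hab => by linarith [Real.exp_injective hab]) F
  rw [himg] at this
  rw [this, Measure.restrict_univ]
  refine lintegral_congr fun t => ?_
  congr 2
  rw [abs_mul, abs_of_pos (Real.exp_pos _), abs_div]
  simp [div_eq_mul_inv]

/-- The bottom row is `(-rw, w)` with `w = e^{-t/2}`, so its area element is `w dr · (w/2) dt = ½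
e^{-t} dr dt` up to orientation, and the unipotent coordinate differs from `x` by a function of the
bottom row. These coordinates reach only `m₁₁ > 0` (indices from zero), hence the support condition.
-/
lemma lintegral_haarSL_horoCoord {f : SL(2, ℝ) → ℝ≥0∞} (hf : Measurable f)
    (h0 : ∀ m : SL(2, ℝ), m 1 1 ≤ 0 → f m = 0) :
    ∫⁻ m, f m ∂haarSL =
      ∫⁻ x : ℝ, ∫⁻ t : ℝ, ENNReal.ofReal (Real.exp (-t) / 2) * ∫⁻ r : ℝ, f (horoCoord x t r) := by
  let c : ℝ × ℝ → ℝ := fun v => v.1 / ((v.1 ^ 2 + v.2 ^ 2) * v.2)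
  have hc : Measurable c := by fun_prop
  have hG : Measurable fun p : (ℝ × ℝ) × ℝ => f (frame p.1 (p.2 + c p.1)) :=
    hf.comp (measurable_frame.comp (measurable_fst.prodMk (measurable_snd.add (hc.comp measurable_fst))))
  have hG1 : Measurable fun v : ℝ × ℝ => ∫⁻ x : ℝ, f (frame v (x + c v)) := hG.lintegral_prod_right'
  have hshift : ∀ v : ℝ × ℝ, ∫⁻ s : ℝ, f (frame v s) = ∫⁻ x : ℝ, f (frame v (x + c v)) := fun v =>
    (lintegral_add_right_eq_self (fun s => f (frame v s)) (c v)).symm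
  have hzero : ∀ w : ℝ, w < 0 → ∀ y x : ℝ, f (frame (y, w) (x + c (y, w))) = 0 := by
    intro w hw y x
    have hne : ((y, w) : ℝ × ℝ) ≠ 0 := fun h => hw.ne (congrArg Prod.snd h)
    refine h0 _ ?_
    rw [frame_coe hne]
    exact hw.le
  rw [lintegral_haarSL hf]
  simp_rw [hshift]
  rw [Measure.volume_eq_prod, lintegral_prod_symm _ hG1.aemeasurable]
  have hset : ∫⁻ w : ℝ, ∫⁻ y : ℝ, ∫⁻ x : ℝ, f (frame (y, w) (x + c (y, w))) =
      ∫⁻ w in Ioi (0 : ℝ), ∫⁻ y : ℝ, ∫⁻ x : ℝ, f (frame (y, w) (x + c (y, w))) := by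
    rw [← lintegral_indicator measurableSet_Ioi]
    refine lintegral_congr_ae ?_
    filter_upwards [Measure.ae_ne volume 0] with w hw
    rcases hw.lt_or_gt with hw | hw
    · rw [indicator_of_notMem (notMem_Ioi.2 hw.le)]
      simp [hzero w hw]
    · rw [indicator_of_mem (mem_Ioi.2 hw)]
  rw [hset, lintegral_Ioi_exp]
  have hF : Measurable fun p : ℝ × ℝ × ℝ => f (horoCoord p.1 p.2.1 p.2.2) :=
    hf.comp measurable_horoCoord
  have hF1 : Measurable fun p : ℝ × ℝ => ENNReal.ofReal (Real.exp (-p.2) / 2) *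
      ∫⁻ r : ℝ, f (horoCoord p.1 p.2 r) := by
    refine (ENNReal.measurable_ofReal.comp (by fun_prop)).mul ?_
    exact (hF.comp (MeasurableEquiv.prodAssoc.measurable)).lintegral_prod_right'
  rw [lintegral_lintegral_swap (f := fun x t => ENNReal.ofReal (Real.exp (-t) / 2) *
      ∫⁻ r : ℝ, f (horoCoord x t r)) hF1.aemeasurable]
  refine lintegral_congr fun t => ?_
  have hF2 : Measurable fun p : ℝ × ℝ => f (horoCoord p.1 t p.2) :=
    hf.comp (measurable_horoCoord_slice t)
  have hF3 : Measurable fun x : ℝ => ∫⁻ r : ℝ, f (horoCoord x t r) := hF2.lintegral_prod_right'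
  rw [lintegral_eq_scale (Real.exp_pos (-t / 2)), ← mul_assoc, ← ENNReal.ofReal_mul (by positivity),
    lintegral_const_mul _ hF3, lintegral_lintegral_swap (f := fun x r => f (horoCoord x t r)) hF2.aemeasurable]
  congr 1
  · congr 1
    rw [div_mul_eq_mul_div, ← Real.exp_add]
    ring_nf
  · simp only [c, frame_eq_horoCoord]

/-- In coordinates centred at the cusp `κ`: the matrices on the part of the unstable horocycle
between a point of the `κ`-th section and its first return. -/
def flowBox (Γ : Subgroup SL(2, ℝ)) {K : ℕ} (g : Fin K → SL(2, ℝ)) (σ : Fin K → ℝ) (κ : Fin K) :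
    Set SL(2, ℝ) :=
  {m | 0 < m 1 1 ∧ Real.exp (σ κ / 2) * m 1 1 ≤ 1 ∧ m 1 0 ≤ 0 ∧ m 0 1 / m 1 1 ∈ Ico (0 : ℝ) 1 ∧
    ∀ u ∈ cuspVectors Γ g σ ((g κ)⁻¹ * m), 0 < u.2 → u.2 ≤ 1 → u.1 ≤ 0 →
      u.1 * m 1 1 ≤ m 1 0 * u.2}

lemma measurableSet_flowBox [Countable Γ] (κ : Fin K) : MeasurableSet (flowBox Γ g σ κ) := by
  have hL : MeasurableSet {m : SL(2, ℝ) | ∀ u ∈ cuspVectors Γ g σ ((g κ)⁻¹ * m),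
      0 < u.2 → u.2 ≤ 1 → u.1 ≤ 0 → u.1 * m 1 1 ≤ m 1 0 * u.2} := by
    have : {m : SL(2, ℝ) | ∀ u ∈ cuspVectors Γ g σ ((g κ)⁻¹ * m),
        0 < u.2 → u.2 ≤ 1 → u.1 ≤ 0 → u.1 * m 1 1 ≤ m 1 0 * u.2} = ⋂ (ℓ : Fin K) (γ : Γ),
        (fun m : SL(2, ℝ) => (Real.exp (σ ℓ / 2) • bottomRow (g ℓ * γ * ((g κ)⁻¹ * m)), bottomRow m)) ⁻¹'
          {p : (ℝ × ℝ) × (ℝ × ℝ) | 0 < p.1.2 → p.1.2 ≤ 1 → p.1.1 ≤ 0 →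
            p.1.1 * p.2.2 ≤ p.2.1 * p.1.2} := by
      ext m
      simp only [mem_iInter]
      constructor
      · intro hh ℓ γ
        exact hh _ ⟨ℓ, γ, γ.2, rfl⟩
      · rintro hh _ ⟨ℓ, γ, hγ, rfl⟩
        exact hh ℓ ⟨γ, hγ⟩
    rw [this]
    refine MeasurableSet.iInter fun ℓ => MeasurableSet.iInter fun γ =>
      (((measurable_cuspVector ℓ (γ : SL(2, ℝ))).comp
        (measurable_SL_mul_left (g κ)⁻¹)).prodMk measurable_bottomRow) ?_
    refine MeasurableSet.imp (measurableSet_lt (by fun_prop) (by fun_prop)) <|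
      MeasurableSet.imp (measurableSet_le (by fun_prop) (by fun_prop)) <|
      MeasurableSet.imp (measurableSet_le (by fun_prop) (by fun_prop)) <|
      measurableSet_le (by fun_prop) (by fun_prop)
  exact (measurableSet_lt measurable_const (measurable_entry 1 1)).inter <|
    (measurableSet_le ((measurable_entry 1 1).const_mul _) measurable_const).inter <|
    (measurableSet_le (measurable_entry 1 0) measurable_const).inter <|
    (((measurable_entry 0 1).div (measurable_entry 1 1)) measurableSet_Ico).inter hL

/-- Flowing for time `r` lowers all slopes by `r`. The box condition that no nonpositive slope
exceeds `-r` therefore says that no cusp vector at the section point has slope in `(0, r]`. -/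
lemma horoCoord_mem_flowBox [DiscreteTopology Γ] (hg : IsCuspSystem Γ g) (κ : Fin K) (x t r : ℝ) :
    horoCoord x t r ∈ flowBox Γ g σ κ ↔
      x ∈ Ico (0 : ℝ) 1 ∧ σ κ ≤ t ∧ 0 ≤ r ∧ ENNReal.ofReal r < returnTime Γ g σ x t κ := by
  have hw := Real.exp_pos (-t / 2)
  have h11 : horoCoord x t r 1 1 = Real.exp (-t / 2) := by
    simp only [horoCoord, mul_apply_two]; simp
  have h10 : horoCoord x t r 1 0 = -r * Real.exp (-t / 2) := by
    simp only [horoCoord, mul_apply_two]; simp [mul_comm]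
  have h01 : horoCoord x t r 0 1 = x * Real.exp (-t / 2) := by
    simp only [horoCoord, mul_apply_two]; simp
  have hL : cuspVectors Γ g σ ((g κ)⁻¹ * horoCoord x t r) =
      rowMul (lowerUni (-r)) '' cuspVectors Γ g σ (sectionPoint g x t κ) := by
    rw [← cuspVectors_mul_right, sectionPoint, horoCoord]
    simp only [mul_assoc]
  have hx : x * Real.exp (-t / 2) / Real.exp (-t / 2) = x := by field_simp
  have ht : Real.exp (σ κ / 2) * Real.exp (-t / 2) ≤ 1 ↔ σ κ ≤ t := by
    rw [← Real.exp_add, Real.exp_le_one_iff]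
    constructor <;> intro h <;> linarith
  have hr : -r * Real.exp (-t / 2) ≤ 0 ↔ 0 ≤ r := by
    rw [neg_mul, neg_nonpos, mul_nonneg_iff_of_pos_right hw]
  simp only [flowBox, mem_ofPred_eq, h11, h10, h01, hL, forall_mem_image, hx, ht, hr,
    rowMul_lowerUni, hw, true_and]
  have hlast : 0 ≤ r → ((∀ u ∈ cuspVectors Γ g σ (sectionPoint g x t κ), 0 < u.2 → u.2 ≤ 1 →
      u.1 + -r * u.2 ≤ 0 →
      (u.1 + -r * u.2) * Real.exp (-t / 2) ≤ -r * Real.exp (-t / 2) * u.2) ↔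
      ENNReal.ofReal r < returnTime Γ g σ x t κ) := by
    intro hr0
    rw [ofReal_lt_returnTime_iff hg hr0]
    refine forall₂_congr fun u _ => forall₂_congr fun _ _ => ?_
    rw [show -r * Real.exp (-t / 2) * u.2 = (-r * u.2) * Real.exp (-t / 2) by ring,
      mul_le_mul_iff_left₀ hw]
    constructor
    · intro h h0
      by_contra! hle
      linarith [h (by linarith)]
    · intro h h0
      by_contra! hlt
      linarith [h (by linarith)]
  constructor
  · rintro ⟨a, b, c, d⟩
    exact ⟨c, a, b, (hlast b).1 d⟩
  · rintro ⟨a, b, c, d⟩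
    exact ⟨b, c, a, (hlast c).2 d⟩

lemma volume_ofReal_lt (η : ℝ≥0∞) : volume {r : ℝ | 0 ≤ r ∧ ENNReal.ofReal r < η} = η := by
  rcases eq_or_ne η ⊤ with rfl | hη
  · have : {r : ℝ | 0 ≤ r ∧ ENNReal.ofReal r < ⊤} = Ici 0 := by
      ext r
      simp
    rw [this, Real.volume_Ici]
  · have : {r : ℝ | 0 ≤ r ∧ ENNReal.ofReal r < η} = Ico 0 η.toReal := by
      ext r
      exact and_congr_right fun hr => ENNReal.ofReal_lt_iff_lt_toReal hr hη
    rw [this, Real.volume_Ico, sub_zero, ENNReal.ofReal_toReal hη]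

/-- Over each section point the box is the interval `[0, η₁)`, of length `η₁` even when this is
infinite; the factor `2` cancels the `½` in the Haar density. -/
lemma two_mul_haarSL_flowBox [DiscreteTopology Γ] (hg : IsCuspSystem Γ g) (κ : Fin K) :
    2 * haarSL (flowBox Γ g σ κ) = ∫⁻ s in Ico (0 : ℝ) 1, ∫⁻ t in Ici (σ κ),
      returnTime Γ g σ s t κ * ENNReal.ofReal (Real.exp (-t)) := by
  classical
  have := countable_of_discrete Γ
  have hm := measurableSet_flowBox (Γ := Γ) (g := g) (σ := σ) κ
  rw [← lintegral_indicator_one hm, lintegral_haarSL_horoCoord (measurable_one.indicator hm)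
    (fun m hm' => indicator_of_notMem (fun h => not_lt.2 hm' h.1) _),
    ← lintegral_const_mul' _ _ ENNReal.ofNat_ne_top, ← lintegral_indicator measurableSet_Ico]
  refine lintegral_congr fun x => ?_
  rw [← lintegral_const_mul' _ _ ENNReal.ofNat_ne_top]
  by_cases hx : x ∈ Ico (0 : ℝ) 1
  · rw [indicator_of_mem hx, ← lintegral_indicator measurableSet_Ici]
    refine lintegral_congr fun t => ?_
    by_cases ht : t ∈ Ici (σ κ)
    · have hind : ∀ r, (flowBox Γ g σ κ).indicator (1 : SL(2, ℝ) → ℝ≥0∞) (horoCoord x t r) =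
          {r : ℝ | 0 ≤ r ∧ ENNReal.ofReal r < returnTime Γ g σ x t κ}.indicator 1 r := by
        intro r
        simp only [indicator_apply]
        refine if_congr ?_ rfl rfl
        rw [horoCoord_mem_flowBox hg]
        exact ⟨fun h => h.2.2, fun h => ⟨hx, ht, h⟩⟩
      have hms : MeasurableSet {r : ℝ | 0 ≤ r ∧ ENNReal.ofReal r < returnTime Γ g σ x t κ} :=
        measurableSet_Ici.inter (ENNReal.measurable_ofReal measurableSet_Iio)
      simp_rw [hind]
      rw [indicator_of_mem ht, lintegral_indicator_one hms, volume_ofReal_lt, ← mul_assoc,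
        mul_comm _ (returnTime Γ g σ x t κ)]
      congr 1
      rw [show (2 : ℝ≥0∞) = ENNReal.ofReal 2 by simp, ← ENNReal.ofReal_mul zero_le_two]
      congr 1
      ring
    · rw [indicator_of_notMem ht]
      have : ∀ r, (flowBox Γ g σ κ).indicator (1 : SL(2, ℝ) → ℝ≥0∞) (horoCoord x t r) = 0 :=
        fun r => indicator_of_notMem
          (fun h => ht ((horoCoord_mem_flowBox hg κ x t r).1 h).2.1) _
      simp [this]
  · rw [indicator_of_notMem hx]
    have : ∀ t r, (flowBox Γ g σ κ).indicator (1 : SL(2, ℝ) → ℝ≥0∞) (horoCoord x t r) = 0 :=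
      fun t r => indicator_of_notMem
        (fun h => hx ((horoCoord_mem_flowBox hg κ x t r).1 h).1) _
    simp [this]

/-! ### The flow boxes form a fundamental domain -/

lemma smul_boundaryPoint_eq_iff (γ : SL(2, ℝ)) (κ κ' : Fin K) :
    Matrix.SpecialLinearGroup.toGL γ • boundaryPoint (g κ) = boundaryPoint (g κ') ↔
      (g κ' * γ * (g κ)⁻¹) 1 0 = 0 := by
  rw [boundaryPoint, boundaryPoint, ← mul_smul, ← map_mul, map_inv, eq_inv_smul_iff, ← mul_smul,
    ← map_mul, OnePoint.smul_infty_eq_self_iff, mul_assoc]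
  rfl

/-- The conjugate of `n(1)` is the required parabolic element: it is not scalar and has trace `2`.
-/
lemma isCusp_boundaryPoint (hg : IsCuspSystem Γ g) (κ : Fin K) :
    IsCusp (boundaryPoint (g κ)) (Γ.map Matrix.SpecialLinearGroup.toGL) := by
  have h := (hg.width_one κ ((g κ)⁻¹ * upperUni (1 : ℤ) * g κ)).2 ⟨1, Or.inl rfl⟩
  refine ⟨_, ⟨_, h.1, rfl⟩, ?_, h.2⟩
  rw [Int.cast_one, conj_upperUni_one]
  change (unipotent (bottomRow (g κ)) : Matrix (Fin 2) (Fin 2) ℝ).IsParabolic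
  refine ⟨?_, ?_⟩
  · rintro ⟨c, hc⟩
    have h1 := congrFun (congrFun hc 0) 1
    have h2 := congrFun (congrFun hc 1) 0
    simp [unipotent] at h1 h2
    exact bottomRow_ne_zero (g κ) (Prod.ext h2 ((pow_eq_zero_iff two_ne_zero).1 h1.symm))
  · rw [Matrix.discr_fin_two, Matrix.trace_fin_two, Matrix.SpecialLinearGroup.det_coe]
    simp [unipotent]
    norm_num

lemma eq_of_smul_boundaryPoint (hg : IsCuspSystem Γ g) {γ : SL(2, ℝ)} (hγ : γ ∈ Γ) {κ κ' : Fin K}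
    (h : Matrix.SpecialLinearGroup.toGL γ • boundaryPoint (g κ) = boundaryPoint (g κ')) : κ = κ' :=
  (hg.complete _ (isCusp_boundaryPoint hg κ)).unique ⟨1, Γ.one_mem, by simp⟩ ⟨γ, hγ, h⟩

/-- Each box singles out a cusp vector of maximal nonpositive slope, so the two vectors are parallel
and `γ` carries cusp `κ` to cusp `κ'`. Inequivalence gives `κ = κ'`, and `γ` is `±` a conjugate of
`n(m)`. Positivity of the lower right entry excludes the minus sign, and `x ∈ [0,1)` forces `m = 0`.
-/
lemma eq_one_of_mem_flowBox (hg : IsCuspSystem Γ g) {γ h : SL(2, ℝ)} (hγ : γ ∈ Γ) {κ κ' : Fin K}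
    (h1 : g κ * h ∈ flowBox Γ g σ κ) (h2 : g κ' * (γ * h) ∈ flowBox Γ g σ κ') :
    κ = κ' ∧ γ = 1 := by
  obtain ⟨a1, a2, a3, a4, a5⟩ := h1
  obtain ⟨b1, b2, b3, b4, b5⟩ := h2
  rw [inv_mul_cancel_left] at a5 b5
  rw [cuspVectors_mul_left hγ] at b5
  have e := Real.exp_pos (σ κ / 2)
  have e' := Real.exp_pos (σ κ' / 2)
  have c1 := a5 _ ⟨κ', γ, hγ, rfl⟩ (by rw [mul_assoc]; exact mul_pos e' b1)
    (by rw [mul_assoc]; exact b2) (by rw [mul_assoc]; exact mul_nonpos_of_nonneg_of_nonpos e'.le b3)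
  have c2 := b5 _ ⟨κ, 1, Γ.one_mem, rfl⟩ (by rw [mul_one]; exact mul_pos e a1)
    (by rw [mul_one]; exact a2) (by rw [mul_one]; exact mul_nonpos_of_nonneg_of_nonpos e.le a3)
  simp only [Prod.smul_fst, Prod.smul_snd, smul_eq_mul, bottomRow_one_zero, bottomRow_one_one,
    mul_one, mul_assoc (g κ') γ h] at c1 c2
  set a := g κ * h with ha
  set b := g κ' * (γ * h) with hb
  have hpar : b 1 0 * a 1 1 = a 1 0 * b 1 1 := by
    apply le_antisymm
    · exact le_of_mul_le_mul_left (by linarith) e'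
    · exact le_of_mul_le_mul_left (by linarith) e
  have hM : g κ' * γ * (g κ)⁻¹ = b * a⁻¹ := by rw [ha, hb]; group
  have hfix : Matrix.SpecialLinearGroup.toGL γ • boundaryPoint (g κ) = boundaryPoint (g κ') := by
    rw [smul_boundaryPoint_eq_iff, hM, mul_apply_two, Matrix.SpecialLinearGroup.SL2_inv_expl]
    simp
    linarith
  obtain rfl := eq_of_smul_boundaryPoint hg hγ hfix
  refine ⟨rfl, ?_⟩
  obtain ⟨m, hm | hm⟩ := (hg.width_one κ γ).1 ⟨hγ, hfix⟩
  · have hba : b = upperUni m * a := by rw [hb, ha, hm]; group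
    have d11 : b 1 1 = a 1 1 := by rw [hba, mul_apply_two]; simp
    have d01 : b 0 1 = a 0 1 + m * a 1 1 := by rw [hba, mul_apply_two]; simp
    rw [d11, d01, add_div, mul_div_cancel_right₀ _ a1.ne'] at b4
    have hm0 : m = 0 := by
      have l1 : (m : ℝ) < 1 := by linarith [a4.1, b4.2]
      have l2 : (-1 : ℝ) < m := by linarith [a4.2, b4.1]
      have l1' : m < 1 := by exact_mod_cast l1
      have l2' : -1 < m := by exact_mod_cast l2
      omega
    rw [hm, hm0]
    have : upperUni ((0 : ℤ) : ℝ) = 1 := by apply ext_two <;> simp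
    rw [this, mul_one, inv_mul_cancel]
  · have hba : b = -(upperUni m * a) := by
      rw [hb, ha, hm, neg_mul, mul_neg]
      congr 1
      group
    have d11 : b 1 1 = -a 1 1 := by
      rw [hba, Matrix.SpecialLinearGroup.coe_neg, Matrix.neg_apply, mul_apply_two]; simp
    linarith

/-- A cusp vector of largest nonpositive slope marks the last crossing of the section; its `κ` and
`γ` give the box. -/
lemma exists_mem_flowBox [DiscreteTopology Γ] (hg : IsCuspSystem Γ g) {h : SL(2, ℝ)}
    (hh : ∃ u ∈ cuspVectors Γ g σ h, 0 < u.2 ∧ u.2 ≤ 1 ∧ u.1 ≤ 0) :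
    ∃ γ ∈ Γ, ∃ κ, g κ * (γ * h) ∈ flowBox Γ g σ κ := by
  obtain ⟨u₀, hu₀, p0, p1, p2⟩ := hh
  -- Discarding slopes below that of `u₀` bounds the vectors, so local finiteness yields a maximum.
  let B : Set (ℝ × ℝ) :=
    {u | u ∈ cuspVectors Γ g σ h ∧ 0 < u.2 ∧ u.2 ≤ 1 ∧ u.1 ≤ 0 ∧ u₀.1 / u₀.2 ≤ u.1 / u.2}
  have hB : B.Finite := by
    refine (finite_cuspVectors_inter (σ := σ) hg h (max (-(u₀.1 / u₀.2)) 1)).subset ?_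
    rintro u ⟨q0, q1, q2, q3, q4⟩
    have hq : u₀.1 / u₀.2 ≤ 0 := div_nonpos_of_nonpos_of_nonneg p2 p0.le
    have hq5 := (le_div_iff₀ q1).1 q4
    refine ⟨q0, ?_, ?_⟩
    · rw [abs_of_nonpos q3]
      refine le_max_of_le_left ?_
      nlinarith
    · rw [abs_of_pos q1]
      exact le_max_of_le_right q2
  obtain ⟨u, ⟨⟨κ, γ, hγ, rfl⟩, q1, q2, q3, q4⟩, hmax⟩ :=
    exists_max_image B (fun u => u.1 / u.2) hB ⟨u₀, hu₀, p0, p1, p2, le_rfl⟩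
  have e := Real.exp_pos (σ κ / 2)
  set m := g κ * γ * h with hm
  simp only [Prod.smul_fst, Prod.smul_snd, smul_eq_mul, bottomRow_one_zero, bottomRow_one_one]
    at q1 q2 q3 q4 hmax
  rw [mul_div_mul_left _ _ e.ne'] at q4 hmax
  have m11 : 0 < m 1 1 := (mul_pos_iff_of_pos_left e).1 q1
  have m10 : m 1 0 ≤ 0 := by
    by_contra! h0
    linarith [mul_pos e h0]
  -- Left translation by `n(k)` moves `x` into `[0,1)` without changing the bottom row.
  let k : ℤ := -⌊m 0 1 / m 1 1⌋
  have hk : g κ * (((g κ)⁻¹ * upperUni k * g κ * γ) * h) = upperUni k * m := by rw [hm]; group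
  have hγ' : (g κ)⁻¹ * upperUni k * g κ * γ ∈ Γ := Γ.mul_mem (conj_upperUni_mem hg κ k) hγ
  have d11 : (upperUni k * m) 1 1 = m 1 1 := by rw [mul_apply_two]; simp
  have d10 : (upperUni k * m) 1 0 = m 1 0 := by rw [mul_apply_two]; simp
  have d01 : (upperUni k * m) 0 1 = m 0 1 + k * m 1 1 := by rw [mul_apply_two]; simp
  refine ⟨_, hγ', κ, ?_⟩
  have hL : cuspVectors Γ g σ ((g κ)⁻¹ * (upperUni k * m)) = cuspVectors Γ g σ h := by
    rw [← hk, inv_mul_cancel_left, cuspVectors_mul_left hγ']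
  rw [hk]
  simp only [flowBox, mem_ofPred_eq, d11, d10, d01, hL]
  refine ⟨m11, q2, m10, ?_, fun u hu r1 r2 r3 => ?_⟩
  · rw [add_div, mul_div_cancel_right₀ _ m11.ne']
    simp only [k, Int.cast_neg]
    exact ⟨by linarith [Int.floor_le (m 0 1 / m 1 1)],
      by linarith [Int.lt_floor_add_one (m 0 1 / m 1 1)]⟩
  · rw [← div_le_div_iff₀ r1 m11]
    by_cases hc : u₀.1 / u₀.2 ≤ u.1 / u.2
    · exact hmax u ⟨hu, r1, r2, r3, hc⟩
    · exact (not_le.1 hc).le.trans q4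

lemma isFundamentalDomain_flowBoxes [DiscreteTopology Γ] (hneg : (-1 : SL(2, ℝ)) ∈ Γ)
    (hg : IsCuspSystem Γ g) (hK : 0 < K) {D : Set SL(2, ℝ)}
    (hD : IsFundamentalDomain Γ D haarSL) (hfin : haarSL D ≠ ⊤) :
    IsFundamentalDomain Γ (⋃ κ, (fun h => g κ * h) ⁻¹' flowBox Γ g σ κ) haarSL := by
  have := countable_of_discrete Γ
  refine IsFundamentalDomain.mk'' ?_ ?_ ?_
    fun γ => (measurePreserving_mul_left (γ : SL(2, ℝ))).quasiMeasurePreserving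
  · exact (MeasurableSet.iUnion fun κ =>
      measurable_SL_mul_left (g κ) (measurableSet_flowBox κ)).nullMeasurableSet
  · filter_upwards [ae_exists_cuspVector (σ := σ) (g := g) hneg hK hD hfin] with h hh
    obtain ⟨γ, hγ, κ, hmem⟩ := exists_mem_flowBox hg hh
    exact ⟨⟨γ, hγ⟩, mem_iUnion.2 ⟨κ, hmem⟩⟩
  · intro γ hγ
    refine Disjoint.aedisjoint (disjoint_left.2 ?_)
    rintro _ ⟨h, hh, rfl⟩ hh'
    obtain ⟨κ, h1⟩ := mem_iUnion.1 hh
    obtain ⟨κ', h2⟩ := mem_iUnion.1 hh'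
    exact hγ (Subtype.ext (eq_one_of_mem_flowBox hg γ.2 h1 h2).2)

/-! ### The mean return time -/

/-- The lifted domain and the disjoint union of flow boxes are fundamental domains for the same
action, so they have equal Haar measure; twice this measure is `π vol(F)` on one side and the
integral of `η₁` on the other. -/
lemma sectionIntegral_returnTime [DiscreteTopology Γ] (hneg : (-1 : SL(2, ℝ)) ∈ Γ) {F : Set ℍ}
    (hF : IsFundDomain Γ F) (hvol : volume F < ⊤) (hK : 0 < K) (hg : IsCuspSystem Γ g) :
    sectionIntegral σ (returnTime Γ g σ) = ENNReal.ofReal Real.pi * volume F := by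
  have := countable_of_discrete Γ
  have hD := isFundamentalDomain_halfLift hneg hF
  have htwo := two_mul_haarSL_halfLift hF.nullMeasurableSet
  have hfin : haarSL (halfLift F) ≠ ⊤ := by
    intro h
    rw [h, ENNReal.mul_top two_ne_zero] at htwo
    exact ENNReal.mul_ne_top ENNReal.ofReal_ne_top hvol.ne htwo.symm
  have hmeas : ∀ κ, MeasurableSet ((fun h => g κ * h) ⁻¹' flowBox Γ g σ κ) := fun κ =>
    measurable_SL_mul_left (g κ) (measurableSet_flowBox κ)
  rw [← htwo, hD.measure_eq (isFundamentalDomain_flowBoxes (σ := σ) hneg hg hK hD hfin),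
    measure_iUnion (f := fun κ => (fun h => g κ * h) ⁻¹' flowBox Γ g σ κ) (fun κ κ' hne => disjoint_left.2 fun h h1 h2 =>
      hne (eq_one_of_mem_flowBox hg (γ := 1) Γ.one_mem h1 (by rwa [one_mul])).1) hmeas, tsum_fintype,
    Finset.mul_sum, sectionIntegral]
  refine Finset.sum_congr rfl fun κ _ => ?_
  rw [(measurePreserving_mul_left (g κ)).measure_preimage (measurableSet_flowBox κ).nullMeasurableSet,
    two_mul_haarSL_flowBox hg]

lemma sectionIntegral_one (σ : Fin K → ℝ) :
    sectionIntegral σ (fun _ _ _ => 1) = ENNReal.ofReal (∑ κ, Real.exp (-σ κ)) := by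
  have h : ∀ a : ℝ, ∫⁻ t in Ici a, ENNReal.ofReal (Real.exp (-t)) = ENNReal.ofReal (Real.exp (-a)) := by
    intro a
    rw [setLIntegral_congr Ioi_ae_eq_Ici.symm, ← ofReal_integral_eq_lintegral_ofReal
      (integrableOn_exp_neg_Ioi a) (Filter.Eventually.of_forall fun t => (Real.exp_pos _).le),
      integral_exp_neg_Ioi]
  rw [ENNReal.ofReal_sum_of_nonneg fun κ _ => (Real.exp_pos _).le, sectionIntegral]
  simp [h]

end CuspSection

end

theorem mainTheorem10 (Γ : Subgroup SL(2, ℝ)) [DiscreteTopology Γ] (hneg : (-1 : SL(2, ℝ)) ∈ Γ)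
    (F : Set ℍ) (hF : CuspSection.IsFundDomain Γ F)
    (hvol : MeasureTheory.volume F < ⊤)
    (K : ℕ) (hK : 0 < K) (g : Fin K → SL(2, ℝ)) (hg : CuspSection.IsCuspSystem Γ g)
    (σ : Fin K → ℝ) :
    (∀ (r s t : ℝ) (κ : Fin K), 0 < r → s ∈ Set.Ico (0 : ℝ) 1 → σ κ ≤ t →
      CuspSection.density Γ g σ r s t κ =
        1 / (CuspSection.meanReturnTime Γ g σ).toReal *
          ∏ ℓ : Fin K, CuspSection.emptyIndicator
            (CuspSection.scaledSet (Real.exp (σ ℓ / 2)) (CuspSection.cuspOrbit Γ g ℓ)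
              ((g κ)⁻¹ * CuspSection.upperUni s * CuspSection.diagExp t) ∩
                CuspSection.negTriangle r)) ∧
    CuspSection.meanReturnTime Γ g σ =
      ENNReal.ofReal
        (Real.pi * (MeasureTheory.volume F).toReal * (∑ κ : Fin K, Real.exp (-σ κ))⁻¹) := by
  refine ⟨fun r s t κ hr _ _ => CuspSection.density_eq_prod hg hr.le s t κ, ?_⟩
  have : Nonempty (Fin K) := ⟨⟨0, hK⟩⟩
  have hsum : 0 < ∑ κ : Fin K, Real.exp (-σ κ) :=
    Finset.sum_pos (fun κ _ => Real.exp_pos _) Finset.univ_nonempty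
  rw [CuspSection.meanReturnTime, CuspSection.sectionIntegral_returnTime hneg hF hvol hK hg,
    CuspSection.sectionIntegral_one, ← div_eq_mul_inv, ENNReal.ofReal_div_of_pos hsum,
    ENNReal.ofReal_mul Real.pi_pos.le, ENNReal.ofReal_toReal hvol.ne]
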